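/- Let $n\ge 2$ and let $I\subset[0,\infty)$ be one of the intervals $[0,\nu)$ ($\nu>0$), $(\nu_2,\nu_1)$ ($0\le\nu_2<\nu_1$), $[0,\infty)$, $(\nu,\infty)$ ($\nu\ge0$); put $M=\{x\in\mathbb{R}^n : |x|\in I\}$ (a ball, an open annulus or punctured ball, $\mathbb{R}^n$, or the complement of a closed ball or of the origin). Let $g,h:I\to\mathbb{R}$ be $C^\infty$ with $1-2r^2g(r)\neq0$ on $I$, and let $$T(r)=\frac{e^{-\int\frac{4rg(r)}{1-2r^2g(r)}dr}}{(1-2r^2g(r))^2},\qquad \overline T(r)=4\int\frac{g'(r)+2rg(r)^2}{1-2r^2g(r)}\,T(r)\,dr ,$$ where the integrals denote any antiderivatives on $I$. Assume that $T(r)-(r^2-s^2)(\overline T(r)+1)>0$ for all $r\in I$, $|s|\le r$, and put $$\phi(r,s)=s\,h(r)+\frac{\bigl(T(r)-r^2\overline T(r)\bigr)\bigl(T(r)-(r^2-s^2)(\overline T(r)+1)\bigr)+s^2T(r)}{\sqrt{T(r)-(r^2-s^2)(\overline T(r)+1)}\,\bigl(T(r)-r^2(\overline T(r)+1)\bigr)^2}.$$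 Suppose that $\phi(r,s)>0$ for all $r\in I$, $|s|\le r$, and, in case $0\in M$, that $$F(x,y)=|y|\,\phi\!\left(|x|,\frac{\langle x,y\rangle}{|y|}\right)\quad (y\ne0),\qquad F(x,0)=0,$$ is $C^\infty$ at the points $(0,y)$, $y\neq0$. Then $F$ is a Finsler metric on $M$ (it is $C^\infty$ for $y\ne0$, positive for $y\neq 0$, positively homogeneous of degree one in $y$, and $g_{ij}=\tfrac12\,\partial^2(F^2)/\partial y^i\partial y^j$ is positive definite for $y\ne0$). Moreover, with $G^i=\tfrac14 g^{il}\bigl(\tfrac{\partial^2 F^2}{\partial x^k\partial y^l}y^k-\tfrac{\partial F^2}{\partial x^l}\bigr)$: (i) $F$ is a Douglas metric, that is, $\dfrac{\partial^3}{\partial y^j\partial y^k\partial y^l}\Bigl(G^i-\dfrac1{n+1}\sum_m\dfrac{\partial G^m}{\partial y^m}\,y^i\Bigr)=0$ for all $i,j,k,l$, $x\in M$, $y\ne0$; (ii) $F$ is of scalar flag curvature, that is, with $$R^i{}_k=2\frac{\partial G^i}{\partial x^k}-y^j\frac{\partial^2G^i}{\partial x^j\partial y^k}+2G^j\frac{\partial^2G^i}{\partial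 y^j\partial y^k}-\frac{\partial G^i}{\partial y^j}\frac{\partial G^j}{\partial y^k}$$ and $R_y(u)^i=R^i{}_ku^k$, the flag curvature $\dfrac{g_y(R_y(u),u)}{g_y(y,y)g_y(u,u)-g_y(y,u)^2}$ is the same for all $u$ linearly independent of $y$, so it depends only on $x\in M$ and $y\neq0$. -/

import Mathlib

open scoped ContDiff

namespace SphFinsler

noncomputable section

/-- Euclidean space `ℝⁿ`. -/
abbrev E (n : ℕ) : Type := EuclideanSpace ℝ (Fin n)

/-! ### Finsler geometry on an open subset of `ℝⁿ`, in the standard coordinates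

A Finsler function is written `F x y`, with `x` the base point and `y` the tangent vector. -/

/-- The partial derivative `∂f/∂zⁱ` at the point `z`. -/
def partialD {n : ℕ} (i : Fin n) (f : E n → ℝ) (z : E n) : ℝ :=
  fderiv ℝ f z (EuclideanSpace.single i 1)

/-- The fundamental tensor `g_ij(x,y) = ½ ∂²(F²)/∂yⁱ∂yʲ`. -/
def fundTensor {n : ℕ} (F : E n → E n → ℝ) (x y : E n) : Matrix (Fin n) (Fin n) ℝ :=
  Matrix.of fun i j =>
    (1 / 2) * partialD i (fun v => partialD j (fun w => F x w ^ 2) v) y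

/-- The bilinear form `g_y(u,v) = g_ij(x,y) uⁱ vʲ`. -/
def fundForm {n : ℕ} (F : E n → E n → ℝ) (x y u v : E n) : ℝ :=
  ∑ i, ∑ j, fundTensor F x y i j * u i * v j

/-- `F` is a Finsler metric on `U`: it is `C^∞` on the slit tangent bundle, and each `F x` is a
Minkowski norm (positive away from zero, positively homogeneous of degree one, with positive
definite fundamental tensor). -/
structure IsFinslerMetric {n : ℕ} (U : Set (E n)) (F : E n → E n → ℝ) : Prop where
  smooth : ContDiffOn ℝ ∞ (fun p : E n × E n => F p.1 p.2) (U ×ˢ {y : E n | y ≠ 0})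
  pos : ∀ x ∈ U, ∀ y : E n, y ≠ 0 → 0 < F x y
  homog : ∀ x ∈ U, ∀ y : E n, ∀ t : ℝ, 0 ≤ t → F x (t • y) = t * F x y
  posDef : ∀ x ∈ U, ∀ y : E n, y ≠ 0 → ∀ v : E n, v ≠ 0 → 0 < fundForm F x y v v

/-- The geodesic (spray) coefficients
`Gⁱ = ¼ gⁱˡ ( ∂²(F²)/∂xᵏ∂yˡ yᵏ - ∂(F²)/∂xˡ )`. -/
def geodCoeff {n : ℕ} (F : E n → E n → ℝ) (i : Fin n) (x y : E n) : ℝ :=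
  (1 / 4) * ∑ l, (fundTensor F x y)⁻¹ i l *
    ((∑ k, partialD k (fun z => partialD l (fun w => F z w ^ 2) y) x * y k)
      - partialD l (fun z => F z y ^ 2) x)

/-- The Riemann curvature
`Rⁱ_k = 2 ∂Gⁱ/∂xᵏ - yʲ ∂²Gⁱ/∂xʲ∂yᵏ + 2 Gʲ ∂²Gⁱ/∂yʲ∂yᵏ - ∂Gⁱ/∂yʲ ∂Gʲ/∂yᵏ`. -/
def riemannCurv {n : ℕ} (F : E n → E n → ℝ) (i k : Fin n) (x y : E n) : ℝ :=
  2 * partialD k (fun z => geodCoeff F i z y) x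
    - ∑ j, y j * partialD j (fun z => partialD k (fun w => geodCoeff F i z w) y) x
    + 2 * ∑ j, geodCoeff F j x y *
        partialD j (fun v => partialD k (fun w => geodCoeff F i x w) v) y
    - ∑ j, partialD j (fun w => geodCoeff F i x w) y *
        partialD k (fun w => geodCoeff F j x w) y

/-- The Riemann curvature as an endomorphism, `(R_y(u))ⁱ = Rⁱ_k uᵏ`. -/
def riemannMap {n : ℕ} (F : E n → E n → ℝ) (x y u : E n) : E n :=
  WithLp.toLp 2 fun i => ∑ k, riemannCurv F i k x y * u k

/-- The flag curvature `K(P,y)` of the flag `P = span{y,u}` with flagpole `y`. -/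
def flagCurv {n : ℕ} (F : E n → E n → ℝ) (x y u : E n) : ℝ :=
  fundForm F x y (riemannMap F x y u) u /
    (fundForm F x y y y * fundForm F x y u u - fundForm F x y y u ^ 2)

/-- `F` is of scalar flag curvature on `U`: the flag curvature `K(P,y)` depends only on the base
point and the flagpole. -/
def HasScalarFlagCurvature {n : ℕ} (U : Set (E n)) (F : E n → E n → ℝ) : Prop :=
  ∃ K : E n → E n → ℝ, ∀ x ∈ U, ∀ y u : E n, LinearIndependent ℝ ![y, u] →
    flagCurv F x y u = K x y

/-- The Douglas curvature
`D_jⁱ_kl = ∂³/∂yʲ∂yᵏ∂yˡ ( Gⁱ - (1/(n+1)) (∑ₘ ∂Gᵐ/∂yᵐ) yⁱ )`. -/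
def douglasCurv {n : ℕ} (F : E n → E n → ℝ) (i j k l : Fin n) (x y : E n) : ℝ :=
  partialD j (fun a => partialD k (fun b => partialD l (fun w =>
    geodCoeff F i x w
      - 1 / ((n : ℝ) + 1) * (∑ m, partialD m (fun v => geodCoeff F m x v) w) * w i) b) a) y

/-- `F` is a Douglas metric on `U`: its Douglas curvature vanishes. -/
def IsDouglas {n : ℕ} (U : Set (E n)) (F : E n → E n → ℝ) : Prop :=
  ∀ x ∈ U, ∀ y : E n, y ≠ 0 → ∀ i j k l : Fin n, douglasCurv F i j k l x y = 0

/-! ### Spherically symmetric metrics -/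

/-- `I` is the set of values of `|x|` on an open ball about the origin, on an open annulus
(a punctured ball when the inner radius is `0`), on the whole space, or on the complement of a
closed ball (or of the origin). -/
def IsRadiusInterval (I : Set ℝ) : Prop :=
  (∃ ν : ℝ, 0 < ν ∧ I = Set.Ico 0 ν) ∨
  (∃ ν₂ ν₁ : ℝ, 0 ≤ ν₂ ∧ ν₂ < ν₁ ∧ I = Set.Ioo ν₂ ν₁) ∨
  I = Set.Ici 0 ∨
  (∃ ν : ℝ, 0 ≤ ν ∧ I = Set.Ioi ν)

/-- The rotationally invariant domain of all `x ∈ ℝⁿ` with `|x| ∈ I`. -/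
def radialDomain (n : ℕ) (I : Set ℝ) : Set (E n) := {x | ‖x‖ ∈ I}

/-- `F(x,y) = |y| φ(|x|, ⟨x,y⟩/|y|)`. -/
def sphMetric (n : ℕ) (φ : ℝ → ℝ → ℝ) (x y : E n) : ℝ :=
  ‖y‖ * φ ‖x‖ (inner ℝ x y / ‖y‖)

/-- `T = exp(-∫ 4rg/(1-2r²g) dr) / (1-2r²g)²` on `I`, for some choice of the indefinite
integral. -/
def IsT (I : Set ℝ) (g T : ℝ → ℝ) : Prop :=
  ∃ A : ℝ → ℝ,
    (∀ r ∈ I, HasDerivWithinAt A (4 * r * g r / (1 - 2 * r ^ 2 * g r)) I r) ∧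
    ∀ r ∈ I, T r = Real.exp (-A r) / (1 - 2 * r ^ 2 * g r) ^ 2

/-- `Tb = 4 ∫ (g' + 2rg²)/(1-2r²g) T dr` on `I`, for some choice of the indefinite integral. -/
def IsTbar (I : Set ℝ) (g T Tb : ℝ → ℝ) : Prop :=
  ∀ r ∈ I, HasDerivWithinAt Tb
    (4 * ((derivWithin g I r + 2 * r * g r ^ 2) / (1 - 2 * r ^ 2 * g r) * T r)) I r

/-- The function `φ(r,s)` built from `h`, `T` and `Tb`. -/
def phi (h T Tb : ℝ → ℝ) (r s : ℝ) : ℝ :=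
  s * h r +
    ((T r - r ^ 2 * Tb r) * (T r - (r ^ 2 - s ^ 2) * (Tb r + 1)) + s ^ 2 * T r) /
      (Real.sqrt (T r - (r ^ 2 - s ^ 2) * (Tb r + 1)) * (T r - r ^ 2 * (Tb r + 1)) ^ 2)

end

end SphFinsler

namespace SphFinsler

open Topology Filter

variable {n : ℕ}

/-! ### Partial derivatives as values of Fréchet derivatives -/

/-! Write r = |x|, m = ⟨x,y⟩, b = Tb + 1, a = T - r²b and W = a|y|² + bm². Then F = h(r) m + L with
L = ((a + r²) W + T m²) / (a² √W) (`sphMetric_phi_eq`). The one-form h(r)⟨x,dx⟩ is exact, so it does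
not affect the Euler–Lagrange equations.

Spray. T and Tb are made so that F_{xᵏyˡ} yᵏ - F_{xˡ} = 2 Q F_{yˡyᵏ} xᵏ for Q = g|y|² + c m², where
c = (g' + 2rg²) / (r(1 - 2r²g)) (`eulerLagrange_sphMetric`). Since y lies in the kernel of the
vertical Hessian of F, this says that G = P y + Q x, with P of degree one in y
(`geodCoeff_eq_projSpray`).

Douglas. Subtracting the trace of ∂G/∂y removes P y completely, and what is left is quadratic in y
because Q is (`douglasCurv_eq_zero`).

Scalar curvature. In the Riemann curvature of P y + Q x the coefficient of x does not involve P
(`sprayCurv_smul_add_smul`). It is a multiple of g'/r - c + 2g(g + r²c), which vanishes for this c.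
Hence R_y(u) = k u + τ(u) y. Moreover F is constant along its geodesics and its horizontal
derivatives vanish, so the vertical differential of F kills R_y(u) (`fderiv_sprayCurv_eq_zero`).
This expresses τ through k, and the flag curvature is k/F², whatever u is
(`flagCurv_eq_of_isotropic`).

Positive definiteness. The vertical Hessian acts on the complement of y through φ - sφ_s and φ -
sφ_s + (r² - s²)φ_ss, and both are explicit positive quantities (`radialU_pos`, `Uf_add`).

Origin. The coefficients are functions of r and c contains 1/r, so all computations are made for x ≠
0. As F is smooth at (0, y), the Douglas and flag curvatures are continuous in x, and the identities
pass to the limit (`eqOn_of_eqOn_diff_zero`). -/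

lemma sum_partialD_mul (f : E n → ℝ) (z v : E n) :
    ∑ k, partialD k f z * v k = fderiv ℝ f z v := by
  conv_rhs => rw [← (EuclideanSpace.basisFun (Fin n) ℝ).sum_repr v]
  simp [partialD, mul_comm]

lemma partialD_congr {f g : E n → ℝ} {z : E n} (h : f =ᶠ[𝓝 z] g) (i : Fin n) :
    partialD i f z = partialD i g z := by
  unfold partialD; rw [h.fderiv_eq]

lemma fderiv_slice_fst {f : E n × E n → ℝ} {x y : E n} (hf : DifferentiableAt ℝ f (x, y))
    (v : E n) : fderiv ℝ (fun z => f (z, y)) x v = fderiv ℝ f (x, y) (v, 0) := by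
  have h1 : HasFDerivAt (fun z : E n => (z, y)) (ContinuousLinearMap.inl ℝ (E n) (E n)) x :=
    hasFDerivAt_prodMk_left x y
  have := (hf.hasFDerivAt.comp x h1).fderiv
  rw [show (fun z => f (z, y)) = f ∘ (fun z => (z, y)) from rfl, this]
  simp

lemma fderiv_slice_snd {f : E n × E n → ℝ} {x y : E n} (hf : DifferentiableAt ℝ f (x, y))
    (v : E n) : fderiv ℝ (fun z => f (x, z)) y v = fderiv ℝ f (x, y) (0, v) := by
  have h1 : HasFDerivAt (fun z : E n => (x, z)) (ContinuousLinearMap.inr ℝ (E n) (E n)) y :=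
    hasFDerivAt_prodMk_right x y
  have := (hf.hasFDerivAt.comp y h1).fderiv
  rw [show (fun z => f (x, z)) = f ∘ (fun z => (x, z)) from rfl, this]
  simp

lemma partialD_fst {f : E n × E n → ℝ} {x y : E n} (hf : DifferentiableAt ℝ f (x, y))
    (k : Fin n) : partialD k (fun z => f (z, y)) x =
      fderiv ℝ f (x, y) (EuclideanSpace.single k 1, 0) :=
  fderiv_slice_fst hf _

lemma partialD_snd {f : E n × E n → ℝ} {x y : E n} (hf : DifferentiableAt ℝ f (x, y))
    (k : Fin n) : partialD k (fun z => f (x, z)) y =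
      fderiv ℝ f (x, y) (0, EuclideanSpace.single k 1) :=
  fderiv_slice_snd hf _

/-! ### First and second derivatives of smooth maps on open sets. -/

section Smooth

variable {X Z : Type*} [NormedAddCommGroup X] [NormedSpace ℝ X] [NormedAddCommGroup Z]
  [NormedSpace ℝ Z] {Ω : Set X} {f : X → Z}

lemma contDiffOn_fderiv (hΩ : IsOpen Ω) (hf : ContDiffOn ℝ ∞ f Ω) :
    ContDiffOn ℝ ∞ (fderiv ℝ f) Ω :=
  hf.fderiv_of_isOpen hΩ (by simp)

lemma contDiffOn_fderiv_apply (hΩ : IsOpen Ω) (hf : ContDiffOn ℝ ∞ f Ω) {w : X → X}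
    (hw : ContDiffOn ℝ ∞ w Ω) : ContDiffOn ℝ ∞ (fun p => fderiv ℝ f p (w p)) Ω :=
  (contDiffOn_fderiv hΩ hf).clm_apply hw

lemma diffAt_of_contDiffOn (hΩ : IsOpen Ω) (hf : ContDiffOn ℝ ∞ f Ω) {p : X} (hp : p ∈ Ω) :
    DifferentiableAt ℝ f p :=
  (hf.contDiffAt (hΩ.mem_nhds hp)).differentiableAt (by simp)

lemma hasFDerivAt_fderiv_apply (hΩ : IsOpen Ω) (hf : ContDiffOn ℝ ∞ f Ω) {p : X} (hp : p ∈ Ω)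
    {w : X → X} {w' : X →L[ℝ] X} (hw : HasFDerivAt w w' p) :
    HasFDerivAt (fun q => fderiv ℝ f q (w q))
      ((fderiv ℝ f p).comp w' + (fderiv ℝ (fderiv ℝ f) p).flip (w p)) p :=
  (diffAt_of_contDiffOn hΩ (contDiffOn_fderiv hΩ hf) hp).hasFDerivAt.clm_apply hw

lemma fderiv_fderiv_apply (hΩ : IsOpen Ω) (hf : ContDiffOn ℝ ∞ f Ω) {p : X} (hp : p ∈ Ω)
    (v w : X) : fderiv ℝ (fun q => fderiv ℝ f q w) p v = fderiv ℝ (fderiv ℝ f) p v w := by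
  rw [(hasFDerivAt_fderiv_apply hΩ hf hp (hasFDerivAt_const w p)).fderiv]
  simp

lemma fderiv_fderiv_symm (hΩ : IsOpen Ω) (hf : ContDiffOn ℝ ∞ f Ω) {p : X} (hp : p ∈ Ω)
    (v w : X) : fderiv ℝ (fderiv ℝ f) p v w = fderiv ℝ (fderiv ℝ f) p w v :=
  ((hf.contDiffAt (hΩ.mem_nhds hp)).isSymmSndFDerivAt
    (by simpa using WithTop.coe_le_coe.2 (le_top : (2 : ℕ∞) ≤ ⊤))) v w

end Smooth

variable {Ω : Set (E n × E n)}

/-- The slit tangent bundle over `U`. -/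
abbrev slit (U : Set (E n)) : Set (E n × E n) := U ×ˢ {y : E n | y ≠ 0}

lemma isOpen_slit {U : Set (E n)} (hU : IsOpen U) : IsOpen (slit U) :=
  hU.prod isOpen_ne

lemma contDiffOn_partialD_fst (hΩ : IsOpen Ω) {f : E n × E n → ℝ} (hf : ContDiffOn ℝ ∞ f Ω)
    (k : Fin n) : ContDiffOn ℝ ∞ (fun p => partialD k (fun z => f (z, p.2)) p.1) Ω := by
  refine (contDiffOn_fderiv_apply hΩ hf
    (contDiffOn_const (c := ((EuclideanSpace.single k 1 : E n), (0 : E n))))).congr ?_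
  rintro ⟨x, y⟩ hp
  exact partialD_fst (diffAt_of_contDiffOn hΩ hf hp) k

lemma contDiffOn_partialD_snd (hΩ : IsOpen Ω) {f : E n × E n → ℝ} (hf : ContDiffOn ℝ ∞ f Ω)
    (k : Fin n) : ContDiffOn ℝ ∞ (fun p => partialD k (fun z => f (p.1, z)) p.2) Ω := by
  refine (contDiffOn_fderiv_apply hΩ hf
    (contDiffOn_const (c := ((0 : E n), (EuclideanSpace.single k 1 : E n))))).congr ?_
  rintro ⟨x, y⟩ hp
  exact partialD_snd (diffAt_of_contDiffOn hΩ hf hp) k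

/-! ### Smoothness of the geometric quantities -/

lemma contDiffOn_matrix_det {X : Type*} [NormedAddCommGroup X] [NormedSpace ℝ X] {Ω : Set X}
    {M : X → Matrix (Fin n) (Fin n) ℝ} (hM : ∀ i j, ContDiffOn ℝ ∞ (fun p => M p i j) Ω) :
    ContDiffOn ℝ ∞ (fun p => (M p).det) Ω := by
  simp only [Matrix.det_apply, Units.smul_def, zsmul_eq_mul]
  exact ContDiffOn.sum fun σ _ => contDiffOn_const.mul (contDiffOn_prod fun i _ => hM _ _)

lemma contDiffOn_matrix_inv {X : Type*} [NormedAddCommGroup X] [NormedSpace ℝ X] {Ω : Set X}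
    {M : X → Matrix (Fin n) (Fin n) ℝ} (hM : ∀ i j, ContDiffOn ℝ ∞ (fun p => M p i j) Ω)
    (hdet : ∀ p ∈ Ω, (M p).det ≠ 0) (i j : Fin n) :
    ContDiffOn ℝ ∞ (fun p => (M p)⁻¹ i j) Ω := by
  simp only [Matrix.inv_def, Matrix.smul_apply, Ring.inverse_eq_inv', smul_eq_mul,
    Matrix.adjugate_apply]
  refine ((contDiffOn_matrix_det hM).inv hdet).mul (contDiffOn_matrix_det fun k l => ?_)
  simp only [Matrix.updateRow_apply]
  split_ifs
  · exact contDiffOn_const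
  · exact hM k l

section Metric

variable {U : Set (E n)} {F : E n → E n → ℝ}

lemma contDiffOn_sq (hF : IsFinslerMetric U F) :
    ContDiffOn ℝ ∞ (fun p : E n × E n => F p.1 p.2 ^ 2) (slit U) :=
  hF.smooth.pow 2

lemma contDiffOn_fundTensor (hU : IsOpen U) (hF : IsFinslerMetric U F) (i j : Fin n) :
    ContDiffOn ℝ ∞ (fun p : E n × E n => fundTensor F p.1 p.2 i j) (slit U) := by
  have h1 := contDiffOn_partialD_snd (isOpen_slit hU) (contDiffOn_sq hF) j
  have h2 := contDiffOn_partialD_snd (isOpen_slit hU) h1 i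
  exact contDiffOn_const.mul h2

/-- A kernel vector would be a null vector of a positive definite form. The inverse matrix in the
spray coefficients is therefore a genuine one and depends smoothly on (x, y). -/
lemma det_fundTensor_ne_zero (hF : IsFinslerMetric U F) {x y : E n} (hx : x ∈ U) (hy : y ≠ 0) :
    (fundTensor F x y).det ≠ 0 := by
  intro h0
  obtain ⟨v, hv, hv0⟩ := Matrix.exists_mulVec_eq_zero_iff.2 h0
  have h := hF.posDef x hx y hy (WithLp.toLp 2 v) (by simpa using hv)
  have : fundForm F x y (WithLp.toLp 2 v) (WithLp.toLp 2 v) =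
      ∑ i, v i * (fundTensor F x y).mulVec v i := by
    simp only [fundForm, Matrix.mulVec, dotProduct, Finset.mul_sum]
    exact Finset.sum_congr rfl fun i _ => Finset.sum_congr rfl fun j _ => by ring
  rw [this, hv0] at h
  simp at h

lemma contDiffOn_geodCoeff (hU : IsOpen U) (hF : IsFinslerMetric U F) (i : Fin n) :
    ContDiffOn ℝ ∞ (fun p : E n × E n => geodCoeff F i p.1 p.2) (slit U) := by
  have hΩ := isOpen_slit hU
  unfold geodCoeff
  refine contDiffOn_const.mul (ContDiffOn.sum fun l _ => ?_)
  refine (contDiffOn_matrix_inv (contDiffOn_fundTensor hU hF)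
    (fun p hp => det_fundTensor_ne_zero hF hp.1 hp.2) i l).mul (ContDiffOn.sub ?_ ?_)
  · refine ContDiffOn.sum fun k _ => ContDiffOn.mul ?_ ?_
    · exact contDiffOn_partialD_fst hΩ (contDiffOn_partialD_snd hΩ (contDiffOn_sq hF) l) k
    · exact ((EuclideanSpace.proj k : E n →L[ℝ] ℝ).contDiff.comp contDiff_snd).contDiffOn
  · exact contDiffOn_partialD_fst hΩ (contDiffOn_sq hF) l

lemma contDiffOn_coord_snd (k : Fin n) (Ω : Set (E n × E n)) :
    ContDiffOn ℝ ∞ (fun p : E n × E n => p.2 k) Ω :=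
  ((EuclideanSpace.proj k : E n →L[ℝ] ℝ).contDiff.comp contDiff_snd).contDiffOn

lemma contDiffOn_riemannCurv (hU : IsOpen U) (hF : IsFinslerMetric U F) (i k : Fin n) :
    ContDiffOn ℝ ∞ (fun p : E n × E n => riemannCurv F i k p.1 p.2) (slit U) := by
  have hΩ := isOpen_slit hU
  have hG := contDiffOn_geodCoeff hU hF
  have hN := fun i k => contDiffOn_partialD_snd hΩ (hG i) k
  unfold riemannCurv
  refine ContDiffOn.sub (ContDiffOn.add (ContDiffOn.sub ?_ ?_) ?_) ?_
  · exact contDiffOn_const.mul (contDiffOn_partialD_fst hΩ (hG i) k)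
  · exact ContDiffOn.sum fun j _ => (contDiffOn_coord_snd j _).mul
      (contDiffOn_partialD_fst hΩ (hN i k) j)
  · exact contDiffOn_const.mul (ContDiffOn.sum fun j _ => (hG j).mul
      (contDiffOn_partialD_snd hΩ (hN i k) j))
  · exact ContDiffOn.sum fun j _ => (hN i j).mul (hN j k)

lemma contDiffOn_douglasCurv (hU : IsOpen U) (hF : IsFinslerMetric U F) (i j k l : Fin n) :
    ContDiffOn ℝ ∞ (fun p : E n × E n => douglasCurv F i j k l p.1 p.2) (slit U) := by
  have hΩ := isOpen_slit hU
  have hG := contDiffOn_geodCoeff hU hF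
  have h0 : ContDiffOn ℝ ∞ (fun p : E n × E n => geodCoeff F i p.1 p.2
      - 1 / ((n : ℝ) + 1) * (∑ m, partialD m (fun v => geodCoeff F m p.1 v) p.2) * p.2 i)
      (slit U) :=
    (hG i).sub ((contDiffOn_const.mul (ContDiffOn.sum fun m _ =>
      contDiffOn_partialD_snd hΩ (hG m) m)).mul (contDiffOn_coord_snd i _))
  exact contDiffOn_partialD_snd hΩ (contDiffOn_partialD_snd hΩ
    (contDiffOn_partialD_snd hΩ h0 l) k) j

end Metric

/-! ### Second derivatives -/

lemma sum_apply_inr (φ : E n × E n →L[ℝ] ℝ) (u : E n) :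
    ∑ i, φ (0, EuclideanSpace.single i 1) * u i = φ (0, u) := by
  have h := sum_partialD_mul (fun v => φ (0, v)) 0 u
  have h1 : HasFDerivAt (fun v : E n => φ (0, v))
      (φ.comp (ContinuousLinearMap.inr ℝ (E n) (E n))) 0 :=
    (φ.comp (ContinuousLinearMap.inr ℝ (E n) (E n))).hasFDerivAt
  simpa [partialD, h1.fderiv] using h

lemma sum_apply_inl (φ : E n × E n →L[ℝ] ℝ) (u : E n) :
    ∑ i, φ (EuclideanSpace.single i 1, 0) * u i = φ (u, 0) := by
  have h := sum_partialD_mul (fun v => φ (v, 0)) 0 u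
  have h1 : HasFDerivAt (fun v : E n => φ (v, 0))
      (φ.comp (ContinuousLinearMap.inl ℝ (E n) (E n))) 0 :=
    (φ.comp (ContinuousLinearMap.inl ℝ (E n) (E n))).hasFDerivAt
  simpa [partialD, h1.fderiv] using h

section Second

variable {Ω : Set (E n × E n)} {f : E n × E n → ℝ}

lemma partialD_snd_eventuallyEq (hΩ : IsOpen Ω) (hf : ContDiffOn ℝ ∞ f Ω) {x y : E n}
    (hp : (x, y) ∈ Ω) (j : Fin n) :
    (fun q : E n × E n => partialD j (fun w => f (q.1, w)) q.2) =ᶠ[𝓝 (x, y)]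
      fun q => fderiv ℝ f q (0, EuclideanSpace.single j 1) := by
  filter_upwards [hΩ.mem_nhds hp] with q hq
  exact partialD_snd (diffAt_of_contDiffOn hΩ hf hq) j

lemma partialD_snd_snd (hΩ : IsOpen Ω) (hf : ContDiffOn ℝ ∞ f Ω) {x y : E n}
    (hp : (x, y) ∈ Ω) (i j : Fin n) :
    partialD i (fun v => partialD j (fun w => f (x, w)) v) y =
      fderiv ℝ (fderiv ℝ f) (x, y) (0, EuclideanSpace.single i 1)
        (0, EuclideanSpace.single j 1) := by
  have h := diffAt_of_contDiffOn hΩ (contDiffOn_partialD_snd hΩ hf j) hp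
  rw [partialD_snd (f := fun q : E n × E n => partialD j (fun w => f (q.1, w)) q.2) h i,
    (partialD_snd_eventuallyEq hΩ hf hp j).fderiv_eq, fderiv_fderiv_apply hΩ hf hp]

lemma partialD_fst_snd (hΩ : IsOpen Ω) (hf : ContDiffOn ℝ ∞ f Ω) {x y : E n}
    (hp : (x, y) ∈ Ω) (i j : Fin n) :
    partialD i (fun z => partialD j (fun w => f (z, w)) y) x =
      fderiv ℝ (fderiv ℝ f) (x, y) (EuclideanSpace.single i 1, 0)
        (0, EuclideanSpace.single j 1) := by
  have h := diffAt_of_contDiffOn hΩ (contDiffOn_partialD_snd hΩ hf j) hp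
  rw [partialD_fst (f := fun q : E n × E n => partialD j (fun w => f (q.1, w)) q.2) h i,
    (partialD_snd_eventuallyEq hΩ hf hp j).fderiv_eq, fderiv_fderiv_apply hΩ hf hp]

lemma fderiv_sq_apply (hΩ : IsOpen Ω) (hf : ContDiffOn ℝ ∞ f Ω) {p : E n × E n}
    (hp : p ∈ Ω) (w : E n × E n) :
    fderiv ℝ (fun q => f q ^ 2) p w = 2 * f p * fderiv ℝ f p w := by
  have := ((diffAt_of_contDiffOn hΩ hf hp).hasFDerivAt.pow 2).fderiv
  rw [this]; simp

lemma fderiv_fderiv_sq_apply (hΩ : IsOpen Ω) (hf : ContDiffOn ℝ ∞ f Ω) {p : E n × E n}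
    (hp : p ∈ Ω) (v w : E n × E n) :
    fderiv ℝ (fderiv ℝ (fun q => f q ^ 2)) p v w =
      2 * (fderiv ℝ f p v * fderiv ℝ f p w + f p * fderiv ℝ (fderiv ℝ f) p v w) := by
  rw [← fderiv_fderiv_apply hΩ (hf.pow 2) hp]
  have h : (fun q => fderiv ℝ (fun q => f q ^ 2) q w) =ᶠ[𝓝 p]
      fun q => 2 * f q * fderiv ℝ f q w := by
    filter_upwards [hΩ.mem_nhds hp] with q hq using fderiv_sq_apply hΩ hf hq w
  have h1 := (diffAt_of_contDiffOn hΩ hf hp).hasFDerivAt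
  have h2 := hasFDerivAt_fderiv_apply hΩ hf hp (hasFDerivAt_const w p)
  have h3 : HasFDerivAt (fun q => 2 * f q * fderiv ℝ f q w) _ p := (h1.const_mul 2).mul h2
  rw [h.fderiv_eq, h3.fderiv]
  simp
  ring

end Second

/-! ### The fundamental tensor, the Euler–Lagrange equations and Euler's relations. -/

section Metric

variable {U : Set (E n)} {F : E n → E n → ℝ}

lemma fundTensor_eq (hU : IsOpen U) (hF : ContDiffOn ℝ ∞ (fun p : E n × E n => F p.1 p.2) (slit U))
    {x y : E n} (hp : (x, y) ∈ slit U) (i j : Fin n) :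
    fundTensor F x y i j =
      fderiv ℝ (fun p : E n × E n => F p.1 p.2) (x, y) (0, EuclideanSpace.single i 1) *
        fderiv ℝ (fun p : E n × E n => F p.1 p.2) (x, y) (0, EuclideanSpace.single j 1) +
      F x y * fderiv ℝ (fderiv ℝ (fun p : E n × E n => F p.1 p.2)) (x, y)
        (0, EuclideanSpace.single i 1) (0, EuclideanSpace.single j 1) := by
  have hΩ := isOpen_slit hU
  have h := partialD_snd_snd hΩ (hF.pow 2) hp i j
  simp only [fundTensor, Matrix.of_apply]
  rw [h, fderiv_fderiv_sq_apply hΩ hF hp]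
  ring

lemma fundTensor_row (hU : IsOpen U) (hF : ContDiffOn ℝ ∞ (fun p : E n × E n => F p.1 p.2) (slit U))
    {x y : E n} (hp : (x, y) ∈ slit U) (i : Fin n) (v : E n) :
    ∑ j, fundTensor F x y i j * v j =
      fderiv ℝ (fun p : E n × E n => F p.1 p.2) (x, y) (0, EuclideanSpace.single i 1) *
        fderiv ℝ (fun p : E n × E n => F p.1 p.2) (x, y) (0, v) +
      F x y * fderiv ℝ (fderiv ℝ (fun p : E n × E n => F p.1 p.2)) (x, y)
        (0, EuclideanSpace.single i 1) (0, v) := by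
  simp_rw [fundTensor_eq hU hF hp]
  rw [← sum_apply_inr (fderiv ℝ (fun p : E n × E n => F p.1 p.2) (x, y)) v,
    ← sum_apply_inr (fderiv ℝ (fderiv ℝ (fun p : E n × E n => F p.1 p.2)) (x, y)
        (0, EuclideanSpace.single i 1)) v, Finset.mul_sum, Finset.mul_sum,
    ← Finset.sum_add_distrib]
  exact Finset.sum_congr rfl fun j _ => by ring

lemma fundForm_eq (hU : IsOpen U) (hF : ContDiffOn ℝ ∞ (fun p : E n × E n => F p.1 p.2) (slit U))
    {x y : E n} (hp : (x, y) ∈ slit U) (u v : E n) :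
    fundForm F x y u v =
      fderiv ℝ (fun p : E n × E n => F p.1 p.2) (x, y) (0, u) *
        fderiv ℝ (fun p : E n × E n => F p.1 p.2) (x, y) (0, v) +
      F x y * fderiv ℝ (fderiv ℝ (fun p : E n × E n => F p.1 p.2)) (x, y) (0, u) (0, v) := by
  set f := fun p : E n × E n => F p.1 p.2
  have h1 : fundForm F x y u v = ∑ i, (∑ j, fundTensor F x y i j * v j) * u i := by
    simp only [fundForm, Finset.sum_mul]
    exact Finset.sum_congr rfl fun i _ => Finset.sum_congr rfl fun j _ => by ring
  have h2 := sum_apply_inr ((fderiv ℝ (fderiv ℝ f) (x, y)).flip (0, v)) u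
  simp only [ContinuousLinearMap.flip_apply] at h2
  rw [h1, ← h2, ← sum_apply_inr (fderiv ℝ f (x, y)) u, Finset.sum_mul, Finset.mul_sum,
    ← Finset.sum_add_distrib]
  refine Finset.sum_congr rfl fun i _ => ?_
  rw [fundTensor_row hU hF hp]
  ring

/-- The spray coefficients are characterised by the Euler–Lagrange equations. -/
lemma geodCoeff_eq_of_eulerLagrange (hU : IsOpen U) (hF : IsFinslerMetric U F) {x y : E n}
    (hp : (x, y) ∈ slit U) (G : E n)
    (h1 : fderiv ℝ (fun p : E n × E n => F p.1 p.2) (x, y) (y, 0) =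
      2 * fderiv ℝ (fun p : E n × E n => F p.1 p.2) (x, y) (0, G))
    (h2 : ∀ v, fderiv ℝ (fderiv ℝ (fun p : E n × E n => F p.1 p.2)) (x, y) (y, 0) (0, v) -
      fderiv ℝ (fun p : E n × E n => F p.1 p.2) (x, y) (v, 0) =
      2 * fderiv ℝ (fderiv ℝ (fun p : E n × E n => F p.1 p.2)) (x, y) (0, v) (0, G)) (i : Fin n) :
    geodCoeff F i x y = G i := by
  have hΩ := isOpen_slit hU
  have hrhs : ∀ l, (∑ k, partialD k (fun z => partialD l (fun w => F z w ^ 2) y) x * y k)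
      - partialD l (fun z => F z y ^ 2) x = 4 * (fundTensor F x y).mulVec G l := by
    intro l
    have e1 : (fundTensor F x y).mulVec G l = _ := fundTensor_row hU hF.smooth hp l G
    have e2 : partialD l (fun z => F z y ^ 2) x = _ :=
      partialD_fst (diffAt_of_contDiffOn hΩ (hF.smooth.pow 2) hp) l
    have e3 : ∀ k, partialD k (fun z => partialD l (fun w => F z w ^ 2) y) x = _ :=
      fun k => partialD_fst_snd hΩ (hF.smooth.pow 2) hp k l
    have e4 := sum_apply_inl ((fderiv ℝ (fderiv ℝ (fun q : E n × E n => F q.1 q.2 ^ 2)) (x, y)).flip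
      (0, EuclideanSpace.single l 1)) y
    simp only [ContinuousLinearMap.flip_apply] at e4
    simp_rw [e3]
    rw [e1, e2]
    erw [e4]
    erw [fderiv_sq_apply hΩ hF.smooth hp, fderiv_fderiv_sq_apply hΩ hF.smooth hp]
    -- Expanding F² gives 2F times the Euler–Lagrange expression of F plus 2F_{yˡ} times the
    -- derivative of F along (y, 0); on the other side, g = F_y F_y + F F_yy.
    have h2' := h2 (EuclideanSpace.single l 1)
    linear_combination 2 * F x y * h2' + 2 * fderiv ℝ (fun p : E n × E n => F p.1 p.2) (x, y)
      (0, EuclideanSpace.single l 1) * h1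
  unfold geodCoeff
  simp_rw [hrhs]
  have hdet : IsUnit (fundTensor F x y).det :=
    (det_fundTensor_ne_zero hF hp.1 hp.2).isUnit
  have : ((fundTensor F x y)⁻¹.mulVec ((fundTensor F x y).mulVec G)) i = G i := by
    rw [Matrix.mulVec_mulVec, Matrix.nonsing_inv_mul _ hdet, Matrix.one_mulVec]
  rw [← this]
  simp only [Matrix.mulVec, dotProduct, Finset.mul_sum]
  refine Finset.sum_congr rfl fun l _ => Finset.sum_congr rfl fun k _ => by ring

lemma fderiv_self_of_homog (hU : IsOpen U) (hF : IsFinslerMetric U F) {x y : E n}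
    (hp : (x, y) ∈ slit U) :
    fderiv ℝ (fun p : E n × E n => F p.1 p.2) (x, y) (0, y) = F x y := by
  have hd := (diffAt_of_contDiffOn (isOpen_slit hU) hF.smooth hp).hasFDerivAt
  have hc : HasDerivAt (fun t : ℝ => (x, t • y)) ((0 : E n), y) 1 := by
    have h0 : HasDerivAt (fun t : ℝ => t • y) y 1 := by
      simpa using (hasDerivAt_id (1 : ℝ)).smul_const y
    exact HasDerivAt.prodMk (hasDerivAt_const (1 : ℝ) x) h0
  have h1 : HasDerivAt (fun t : ℝ => F x (t • y))
      (fderiv ℝ (fun p : E n × E n => F p.1 p.2) (x, y) (0, y)) 1 := by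
    have hd' : HasFDerivAt (fun p : E n × E n => F p.1 p.2)
        (fderiv ℝ (fun p : E n × E n => F p.1 p.2) (x, y)) (x, (1 : ℝ) • y) := by
      simpa using hd
    exact hd'.comp_hasDerivAt (1 : ℝ) hc
  have h2 : HasDerivAt (fun t : ℝ => F x (t • y)) (F x y) 1 := by
    have : HasDerivAt (fun t : ℝ => t * F x y) (F x y) 1 := by
      simpa using (hasDerivAt_id (1 : ℝ)).mul_const (F x y)
    refine this.congr_of_eventuallyEq ?_
    filter_upwards [lt_mem_nhds (show (0 : ℝ) < 1 by norm_num)] with t ht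
    exact hF.homog x hp.1 y t ht.le
  exact h1.unique h2

/-- Euler's relation for the second derivative. -/
lemma fderiv_fderiv_self_of_homog (hU : IsOpen U) (hF : IsFinslerMetric U F) {x y : E n}
    (hp : (x, y) ∈ slit U) (w : E n × E n) :
    fderiv ℝ (fderiv ℝ (fun p : E n × E n => F p.1 p.2)) (x, y) w (0, y) =
      fderiv ℝ (fun p : E n × E n => F p.1 p.2) (x, y) w -
      fderiv ℝ (fun p : E n × E n => F p.1 p.2) (x, y) (0, w.2) := by
  have hΩ := isOpen_slit hU
  have hw : HasFDerivAt (fun q : E n × E n => ((0 : E n), q.2))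
      ((0 : E n × E n →L[ℝ] E n).prod (ContinuousLinearMap.snd ℝ (E n) (E n))) (x, y) :=
    (hasFDerivAt_const (0 : E n) (x, y)).prodMk hasFDerivAt_snd
  have h1 := (hasFDerivAt_fderiv_apply hΩ hF.smooth hp hw).fderiv
  have h2 : (fun q : E n × E n => fderiv ℝ (fun p : E n × E n => F p.1 p.2) q (0, q.2)) =ᶠ[𝓝 (x, y)]
      fun p : E n × E n => F p.1 p.2 := by
    filter_upwards [hΩ.mem_nhds hp] with q hq using fderiv_self_of_homog hU hF hq
  rw [h2.fderiv_eq] at h1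
  have h3 := congrArg (fun φ => φ w) h1
  simp at h3
  linarith

end Metric

/-! ### The Riemann curvature of a spray -/

/-- The direction `y ∂/∂x - 2 G ∂/∂y` of the spray with coefficients `G`. -/
noncomputable def sprayDir (G : E n × E n → E n) (q : E n × E n) : E n × E n :=
  (q.2, -((2 : ℝ) • G q))

/-- The Riemann curvature endomorphism of the spray with coefficients `G`. -/
noncomputable def sprayCurv (G : E n × E n → E n) (p : E n × E n) (u : E n) : E n :=
  (2 : ℝ) • fderiv ℝ G p (u, 0) - fderiv ℝ (fderiv ℝ G) p (sprayDir G p) (0, u)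
    - fderiv ℝ G p (0, fderiv ℝ G p (0, u))

section Spray

variable {Ω : Set (E n × E n)} {G : E n × E n → E n}

lemma hasFDerivAt_sprayDir (hΩ : IsOpen Ω) (hG : ContDiffOn ℝ ∞ G Ω) {p : E n × E n}
    (hp : p ∈ Ω) : HasFDerivAt (sprayDir G)
      ((ContinuousLinearMap.snd ℝ (E n) (E n)).prod (-((2 : ℝ) • fderiv ℝ G p))) p :=
  HasFDerivAt.prodMk hasFDerivAt_snd
    (((diffAt_of_contDiffOn hΩ hG hp).hasFDerivAt.const_smul (2 : ℝ)).neg)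

variable {f : E n × E n → ℝ}

/-- The horizontal derivative of `f` vanishes if `f` satisfies the Euler–Lagrange equations. -/
lemma fderiv_fst_eq_of_eulerLagrange (hΩ : IsOpen Ω) (hf : ContDiffOn ℝ ∞ f Ω)
    (hG : ContDiffOn ℝ ∞ G Ω)
    (h1 : ∀ q ∈ Ω, fderiv ℝ f q (sprayDir G q) = 0)
    (h2 : ∀ q ∈ Ω, ∀ v, fderiv ℝ (fderiv ℝ f) q (0, v) (sprayDir G q) = fderiv ℝ f q (v, 0))
    {p : E n × E n} (hp : p ∈ Ω) (v : E n) :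
    fderiv ℝ f p (v, 0) = fderiv ℝ f p (0, fderiv ℝ G p (0, v)) := by
  -- Differentiate the identity Df(S) = 0, S being the spray direction, along (0, v). The derivative
  -- of S is (v, -2 DG(0, v)), and `h2` evaluates the Hessian term as another Df(v, 0).
  have hd := (hasFDerivAt_fderiv_apply hΩ hf hp (hasFDerivAt_sprayDir hΩ hG hp)).fderiv
  have h0 : (fun q => fderiv ℝ f q (sprayDir G q)) =ᶠ[𝓝 p] fun _ => 0 := by
    filter_upwards [hΩ.mem_nhds hp] with q hq using h1 q hq
  rw [h0.fderiv_eq] at hd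
  have h3 := congrArg (fun φ => φ (0, v)) hd
  simp only [fderiv_fun_const, Pi.zero_apply, zero_apply,
    add_apply, ContinuousLinearMap.comp_apply, ContinuousLinearMap.prod_apply,
    ContinuousLinearMap.coe_snd', neg_apply, smul_apply,
    ContinuousLinearMap.flip_apply, h2 p hp] at h3
  have h4 : ((v, -((2 : ℝ) • fderiv ℝ G p (0, v))) : E n × E n) =
      (v, 0) - (2 : ℝ) • (0, fderiv ℝ G p (0, v)) := by simp
  rw [h4, map_sub, map_smul, smul_eq_mul] at h3
  linarith

/-- The Riemann curvature is annihilated by the vertical differential of `f`. -/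
lemma fderiv_sprayCurv_eq_zero (hΩ : IsOpen Ω) (hf : ContDiffOn ℝ ∞ f Ω)
    (hG : ContDiffOn ℝ ∞ G Ω)
    (h1 : ∀ q ∈ Ω, fderiv ℝ f q (sprayDir G q) = 0)
    (h2 : ∀ q ∈ Ω, ∀ v, fderiv ℝ (fderiv ℝ f) q (0, v) (sprayDir G q) = fderiv ℝ f q (v, 0))
    {p : E n × E n} (hp : p ∈ Ω) (u : E n) :
    fderiv ℝ f p (0, sprayCurv G p u) = 0 := by
  have h3 := fun q hq v => fderiv_fst_eq_of_eulerLagrange hΩ hf hG h1 h2 (p := q) hq v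
  -- Conservation of f along the spray, differentiated along (u, 0).
  have h4 : fderiv ℝ (fderiv ℝ f) p (u, 0) (sprayDir G p) =
      2 * fderiv ℝ f p (0, fderiv ℝ G p (u, 0)) := by
    have hd := (hasFDerivAt_fderiv_apply hΩ hf hp (hasFDerivAt_sprayDir hΩ hG hp)).fderiv
    have h0 : (fun q => fderiv ℝ f q (sprayDir G q)) =ᶠ[𝓝 p] fun _ => 0 := by
      filter_upwards [hΩ.mem_nhds hp] with q hq using h1 q hq
    rw [h0.fderiv_eq] at hd
    have h3 := congrArg (fun φ => φ (u, 0)) hd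
    simp only [fderiv_fun_const, Pi.zero_apply, zero_apply,
      add_apply, ContinuousLinearMap.comp_apply,
      ContinuousLinearMap.prod_apply,
      ContinuousLinearMap.coe_snd', neg_apply, smul_apply,
      ContinuousLinearMap.flip_apply] at h3
    have h4 : ((0, -((2 : ℝ) • fderiv ℝ G p (u, 0))) : E n × E n) =
        -((2 : ℝ) • (0, fderiv ℝ G p (u, 0))) := by simp
    rw [h4, map_neg, map_smul, smul_eq_mul] at h3
    linarith
  -- Vanishing of the horizontal derivative, differentiated along the spray. Symmetry of the second
  -- derivative lets this be compared with `h4`; `h6` removes the remaining Hessian term.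
  have h5 : fderiv ℝ (fderiv ℝ f) p (sprayDir G p) (u, 0) =
      fderiv ℝ (fderiv ℝ f) p (sprayDir G p) (0, fderiv ℝ G p (0, u)) +
      fderiv ℝ f p (0, fderiv ℝ (fderiv ℝ G) p (sprayDir G p) (0, u)) := by
    have e1 := fderiv_fderiv_apply hΩ hf hp (sprayDir G p) (u, 0)
    have h0 : (fun q => fderiv ℝ f q (u, 0)) =ᶠ[𝓝 p]
        fun q => fderiv ℝ f q (0, fderiv ℝ G q (0, u)) := by
      filter_upwards [hΩ.mem_nhds hp] with q hq using h3 q hq u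
    have hw : HasFDerivAt (fun q => ((0 : E n), fderiv ℝ G q (0, u))) _ p :=
      HasFDerivAt.prodMk (hasFDerivAt_const (0 : E n) p)
        (hasFDerivAt_fderiv_apply hΩ hG hp (hasFDerivAt_const ((0 : E n), u) p))
    rw [h0.fderiv_eq, (hasFDerivAt_fderiv_apply hΩ hf hp hw).fderiv] at e1
    rw [← e1]
    simp [add_comm]
  have h6 := h2 p hp (fderiv ℝ G p (0, u))
  rw [h3 p hp] at h6
  rw [fderiv_fderiv_symm hΩ hf hp] at h6 h4
  have e : ((0, sprayCurv G p u) : E n × E n) =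
      (2 : ℝ) • (0, fderiv ℝ G p (u, 0)) -
        (0, fderiv ℝ (fderiv ℝ G) p (sprayDir G p) (0, u)) -
        (0, fderiv ℝ G p (0, fderiv ℝ G p (0, u))) := by
    simp [sprayCurv]
  rw [e, map_sub, map_sub, map_smul, smul_eq_mul]
  linarith

/-! ### Sprays of the form `P y + Q x` -/

variable {P Q : E n × E n → ℝ}

lemma fderiv_smul_add_smul (hΩ : IsOpen Ω) (hP : ContDiffOn ℝ ∞ P Ω)
    (hQ : ContDiffOn ℝ ∞ Q Ω) (hGe : ∀ q ∈ Ω, G q = P q • q.2 + Q q • q.1)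
    {p : E n × E n} (hp : p ∈ Ω) (w : E n × E n) :
    fderiv ℝ G p w = P p • w.2 + fderiv ℝ P p w • p.2 + (Q p • w.1 + fderiv ℝ Q p w • p.1) := by
  have h0 : G =ᶠ[𝓝 p] fun q => P q • q.2 + Q q • q.1 := by
    filter_upwards [hΩ.mem_nhds hp] with q hq using hGe q hq
  have hd : HasFDerivAt (fun q : E n × E n => P q • q.2 + Q q • q.1) _ p :=
    ((diffAt_of_contDiffOn hΩ hP hp).hasFDerivAt.smul hasFDerivAt_snd).add
      ((diffAt_of_contDiffOn hΩ hQ hp).hasFDerivAt.smul hasFDerivAt_fst)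
  rw [h0.fderiv_eq, hd.fderiv]
  simp

lemma fderiv_fderiv_smul_add_smul (hΩ : IsOpen Ω) (hP : ContDiffOn ℝ ∞ P Ω)
    (hQ : ContDiffOn ℝ ∞ Q Ω) (hG : ContDiffOn ℝ ∞ G Ω)
    (hGe : ∀ q ∈ Ω, G q = P q • q.2 + Q q • q.1)
    {p : E n × E n} (hp : p ∈ Ω) (w : E n × E n) (u : E n) :
    fderiv ℝ (fderiv ℝ G) p w (0, u) =
      fderiv ℝ P p w • u + (fderiv ℝ P p (0, u) • w.2 + fderiv ℝ (fderiv ℝ P) p w (0, u) • p.2)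
       + (fderiv ℝ Q p (0, u) • w.1 + fderiv ℝ (fderiv ℝ Q) p w (0, u) • p.1) := by
  rw [← fderiv_fderiv_apply hΩ hG hp]
  have h0 : (fun q => fderiv ℝ G q (0, u)) =ᶠ[𝓝 p]
      fun q => P q • u + fderiv ℝ P q (0, u) • q.2 + fderiv ℝ Q q (0, u) • q.1 := by
    filter_upwards [hΩ.mem_nhds hp] with q hq
    rw [fderiv_smul_add_smul hΩ hP hQ hGe hq]
    simp
  have hd : HasFDerivAt (fun q : E n × E n => P q • u + fderiv ℝ P q (0, u) • q.2
      + fderiv ℝ Q q (0, u) • q.1) _ p :=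
    (((diffAt_of_contDiffOn hΩ hP hp).hasFDerivAt.smul_const u).add
      ((hasFDerivAt_fderiv_apply hΩ hP hp (hasFDerivAt_const ((0 : E n), u) p)).smul
        hasFDerivAt_snd)).add
      ((hasFDerivAt_fderiv_apply hΩ hQ hp (hasFDerivAt_const ((0 : E n), u) p)).smul
        hasFDerivAt_fst)
  rw [h0.fderiv_eq, hd.fderiv]
  simp

/-- The curvature of `P y + Q x` is isotropic modulo `y` if the Riemann curvature of `Q x` is. -/
lemma sprayCurv_smul_add_smul (hΩ : IsOpen Ω) (hP : ContDiffOn ℝ ∞ P Ω)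
    (hQ : ContDiffOn ℝ ∞ Q Ω) (hG : ContDiffOn ℝ ∞ G Ω)
    (hGe : ∀ q ∈ Ω, G q = P q • q.2 + Q q • q.1) {x y : E n} (hp : (x, y) ∈ Ω)
    (hQ1 : fderiv ℝ Q (x, y) (0, y) = 2 * Q (x, y))
    (hQ2 : ∀ u, fderiv ℝ (fderiv ℝ Q) (x, y) (0, y) (0, u) = fderiv ℝ Q (x, y) (0, u))
    (hQ3 : ∀ u, 2 * fderiv ℝ Q (x, y) (u, 0) - fderiv ℝ (fderiv ℝ Q) (x, y) (y, 0) (0, u)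
      + 2 * Q (x, y) * fderiv ℝ (fderiv ℝ Q) (x, y) (0, x) (0, u)
      - fderiv ℝ Q (x, y) (0, u) * fderiv ℝ Q (x, y) (0, x) = 0) :
    ∃ (a : ℝ) (τ : E n → ℝ), ∀ u, sprayCurv G (x, y) u = a • u + τ u • y := by
  -- The witnesses are the total coefficients of u and of y in the expanded curvature. In the
  -- coefficient of x all terms containing P cancel, by the degree-two homogeneity of Q (`hQ1`,
  -- `hQ2`), and the rest is the left side of `hQ3`.
  refine ⟨2 * Q (x, y) - fderiv ℝ P (x, y) (sprayDir G (x, y)) - P (x, y) ^ 2, fun u =>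
    2 * fderiv ℝ P (x, y) (u, 0) - fderiv ℝ (fderiv ℝ P) (x, y) (sprayDir G (x, y)) (0, u)
      + 2 * fderiv ℝ P (x, y) (0, u) * P (x, y) - fderiv ℝ Q (x, y) (0, u)
      - fderiv ℝ P (x, y) (0, fderiv ℝ G (x, y) (0, u))
      - P (x, y) * fderiv ℝ P (x, y) (0, u), fun u => ?_⟩
  have hG1 := fun w => fderiv_smul_add_smul hΩ hP hQ hGe hp w
  have eQ : fderiv ℝ Q (x, y) (0, fderiv ℝ G (x, y) (0, u)) =
      P (x, y) * fderiv ℝ Q (x, y) (0, u) + fderiv ℝ P (x, y) (0, u) * (2 * Q (x, y))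
        + fderiv ℝ Q (x, y) (0, u) * fderiv ℝ Q (x, y) (0, x) := by
    have : ((0, fderiv ℝ G (x, y) (0, u)) : E n × E n) =
        P (x, y) • (0, u) + fderiv ℝ P (x, y) (0, u) • (0, y)
          + fderiv ℝ Q (x, y) (0, u) • (0, x) := by
      rw [hG1]; simp
    rw [this]
    simp only [map_add, map_smul, smul_eq_mul, hQ1]
  have eQ2 : fderiv ℝ (fderiv ℝ Q) (x, y) (sprayDir G (x, y)) (0, u) =
      fderiv ℝ (fderiv ℝ Q) (x, y) (y, 0) (0, u) - 2 * P (x, y) * fderiv ℝ Q (x, y) (0, u)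
        - 2 * Q (x, y) * fderiv ℝ (fderiv ℝ Q) (x, y) (0, x) (0, u) := by
    have : sprayDir G (x, y) = (y, 0) - (2 * P (x, y)) • (0, y) - (2 * Q (x, y)) • (0, x) := by
      simp [sprayDir, hGe _ hp, mul_smul]
      abel
    rw [this]
    simp only [map_sub, map_smul, smul_eq_mul, sub_apply,
      smul_apply, hQ2]
  have hx := hQ3 u
  rw [sprayCurv, hG1 (u, 0), hG1 (0, fderiv ℝ G (x, y) (0, u)),
    fderiv_fderiv_smul_add_smul hΩ hP hQ hG hGe hp]
  rw [eQ, eQ2]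
  set D := fderiv ℝ P (x, y) (0, fderiv ℝ G (x, y) (0, u))
  rw [hG1 (0, u)]
  simp only [sprayDir, hGe _ hp]
  set D2 := fderiv ℝ (fderiv ℝ P) (x, y)
    (y, -((2 : ℝ) • (P (x, y) • y + Q (x, y) • x))) (0, u)
  set D1 := fderiv ℝ P (x, y) (y, -((2 : ℝ) • (P (x, y) • y + Q (x, y) • x)))
  have hc : fderiv ℝ (fderiv ℝ Q) (x, y) (y, 0) (0, u) =
      2 * fderiv ℝ Q (x, y) (u, 0)
      + 2 * Q (x, y) * fderiv ℝ (fderiv ℝ Q) (x, y) (0, x) (0, u)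
      - fderiv ℝ Q (x, y) (0, u) * fderiv ℝ Q (x, y) (0, x) := by linarith
  rw [hc]
  module

end Spray

/-! ### Riemann, flag and Douglas curvature of a metric with a known spray. -/

section Metric

variable {U : Set (E n)} {F : E n → E n → ℝ} {G : E n × E n → E n}

lemma fderiv_coord {X : Type*} [NormedAddCommGroup X] [NormedSpace ℝ X] {H : X → E n} {p : X}
    (hH : DifferentiableAt ℝ H p) (i : Fin n) (w : X) :
    fderiv ℝ (fun q => H q i) p w = fderiv ℝ H p w i := by
  have h : HasFDerivAt (fun q => H q i)
      ((EuclideanSpace.proj i : E n →L[ℝ] ℝ).comp (fderiv ℝ H p)) p :=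
    (EuclideanSpace.proj i : E n →L[ℝ] ℝ).hasFDerivAt.comp p hH.hasFDerivAt
  rw [h.fderiv]; rfl

lemma fderiv_geodCoeff (hU : IsOpen U) (hG : ContDiffOn ℝ ∞ G (slit U))
    (hFG : ∀ q ∈ slit U, ∀ i, geodCoeff F i q.1 q.2 = G q i) {p : E n × E n} (hp : p ∈ slit U)
    (i : Fin n) (w : E n × E n) :
    fderiv ℝ (fun q : E n × E n => geodCoeff F i q.1 q.2) p w = fderiv ℝ G p w i := by
  have hΩ := isOpen_slit hU
  have h0 : (fun q : E n × E n => geodCoeff F i q.1 q.2) =ᶠ[𝓝 p] fun q => G q i := by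
    filter_upwards [hΩ.mem_nhds hp] with q hq using hFG q hq i
  rw [h0.fderiv_eq, fderiv_coord (diffAt_of_contDiffOn hΩ hG hp)]

lemma fderiv_fderiv_geodCoeff (hU : IsOpen U) (hF : IsFinslerMetric U F)
    (hG : ContDiffOn ℝ ∞ G (slit U))
    (hFG : ∀ q ∈ slit U, ∀ i, geodCoeff F i q.1 q.2 = G q i) {p : E n × E n} (hp : p ∈ slit U)
    (i : Fin n) (v w : E n × E n) :
    fderiv ℝ (fderiv ℝ (fun q : E n × E n => geodCoeff F i q.1 q.2)) p v w =
      fderiv ℝ (fderiv ℝ G) p v w i := by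
  have hΩ := isOpen_slit hU
  rw [← fderiv_fderiv_apply hΩ (contDiffOn_geodCoeff hU hF i) hp]
  have h0 : (fun q => fderiv ℝ (fun q : E n × E n => geodCoeff F i q.1 q.2) q w) =ᶠ[𝓝 p]
      fun q => fderiv ℝ G q w i := by
    filter_upwards [hΩ.mem_nhds hp] with q hq using fderiv_geodCoeff hU hG hFG hq i w
  rw [h0.fderiv_eq, fderiv_coord (diffAt_of_contDiffOn hΩ
    (contDiffOn_fderiv_apply hΩ hG contDiffOn_const) hp), fderiv_fderiv_apply hΩ hG hp]

lemma sum_mul_apply_inr (φ : E n × E n →L[ℝ] ℝ) (u : E n) :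
    ∑ i, u i * φ (0, EuclideanSpace.single i 1) = φ (0, u) := by
  simp_rw [mul_comm (u _)]; exact sum_apply_inr φ u

lemma sum_mul_apply_inl (φ : E n × E n →L[ℝ] ℝ) (u : E n) :
    ∑ i, u i * φ (EuclideanSpace.single i 1, 0) = φ (u, 0) := by
  simp_rw [mul_comm (u _)]; exact sum_apply_inl φ u

lemma riemannCurv_eq (hU : IsOpen U) (hF : IsFinslerMetric U F) (hG : ContDiffOn ℝ ∞ G (slit U))
    (hFG : ∀ q ∈ slit U, ∀ i, geodCoeff F i q.1 q.2 = G q i) {x y : E n}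
    (hp : (x, y) ∈ slit U) (i k : Fin n) :
    riemannCurv F i k x y = sprayCurv G (x, y) (EuclideanSpace.single k 1) i := by
  have hΩ := isOpen_slit hU
  have hg := contDiffOn_geodCoeff hU hF
  set e : E n := EuclideanSpace.single k 1
  set f := fun q : E n × E n => geodCoeff F i q.1 q.2
  have e1 : partialD k (fun z => geodCoeff F i z y) x = fderiv ℝ G (x, y) (e, 0) i := by
    rw [← fderiv_geodCoeff hU hG hFG hp]
    exact partialD_fst (diffAt_of_contDiffOn hΩ (hg i) hp) k
  have e2 : ∑ j, y j * partialD j (fun z => partialD k (fun w => geodCoeff F i z w) y) x =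
      fderiv ℝ (fderiv ℝ G) (x, y) (y, 0) (0, e) i := by
    rw [← fderiv_fderiv_geodCoeff hU hF hG hFG hp]
    have h := sum_mul_apply_inl ((fderiv ℝ (fderiv ℝ f) (x, y)).flip (0, e)) y
    simp only [ContinuousLinearMap.flip_apply] at h
    rw [← h]
    refine Finset.sum_congr rfl fun j _ => ?_
    congr 1
    exact partialD_fst_snd hΩ (hg i) hp j k
  have e3 : ∑ j, geodCoeff F j x y *
        partialD j (fun v => partialD k (fun w => geodCoeff F i x w) v) y =
      fderiv ℝ (fderiv ℝ G) (x, y) (0, G (x, y)) (0, e) i := by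
    rw [← fderiv_fderiv_geodCoeff hU hF hG hFG hp]
    have h := sum_mul_apply_inr ((fderiv ℝ (fderiv ℝ f) (x, y)).flip (0, e)) (G (x, y))
    simp only [ContinuousLinearMap.flip_apply] at h
    rw [← h]
    refine Finset.sum_congr rfl fun j _ => ?_
    congr 1
    · exact hFG _ hp j
    · exact partialD_snd_snd hΩ (hg i) hp j k
  have e4 : ∑ j, partialD j (fun w => geodCoeff F i x w) y *
        partialD k (fun w => geodCoeff F j x w) y =
      fderiv ℝ G (x, y) (0, fderiv ℝ G (x, y) (0, e)) i := by
    rw [← fderiv_geodCoeff hU hG hFG hp]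
    have h := sum_apply_inr (fderiv ℝ f (x, y)) (fderiv ℝ G (x, y) (0, e))
    rw [← h]
    refine Finset.sum_congr rfl fun j _ => ?_
    congr 1
    · exact partialD_snd (diffAt_of_contDiffOn hΩ (hg i) hp) j
    · rw [← fderiv_geodCoeff hU hG hFG hp]
      exact partialD_snd (diffAt_of_contDiffOn hΩ (hg j) hp) k
  rw [riemannCurv, e1, e2, e3, e4]
  have e5 : sprayDir G (x, y) = (y, 0) - (2 : ℝ) • (0, G (x, y)) := by simp [sprayDir]
  rw [sprayCurv, e5, map_sub, map_smul]
  simp only [sub_apply, smul_apply, PiLp.sub_apply, PiLp.smul_apply, smul_eq_mul]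
  ring

lemma sprayCurv_linear (G : E n × E n → E n) (p : E n × E n) :
    ∃ L : E n →L[ℝ] E n, ∀ u, L u = sprayCurv G p u := by
  refine ⟨(2 : ℝ) • (fderiv ℝ G p).comp (ContinuousLinearMap.inl ℝ _ _)
    - (fderiv ℝ (fderiv ℝ G) p (sprayDir G p)).comp (ContinuousLinearMap.inr ℝ _ _)
    - ((fderiv ℝ G p).comp (ContinuousLinearMap.inr ℝ _ _)).comp
      ((fderiv ℝ G p).comp (ContinuousLinearMap.inr ℝ _ _)), fun u => ?_⟩
  simp [sprayCurv]

lemma riemannMap_eq (hU : IsOpen U) (hF : IsFinslerMetric U F) (hG : ContDiffOn ℝ ∞ G (slit U))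
    (hFG : ∀ q ∈ slit U, ∀ i, geodCoeff F i q.1 q.2 = G q i) {x y : E n}
    (hp : (x, y) ∈ slit U) (u : E n) :
    riemannMap F x y u = sprayCurv G (x, y) u := by
  obtain ⟨L, hL⟩ := sprayCurv_linear G (x, y)
  ext i
  simp only [riemannMap, riemannCurv_eq hU hF hG hFG hp]
  rw [← hL u]
  conv_rhs => rw [← (EuclideanSpace.basisFun (Fin n) ℝ).sum_repr u]
  simp [← hL, mul_comm]

/-- A metric whose Riemann curvature is isotropic modulo the flagpole has scalar flag curvature. -/
lemma flagCurv_eq_of_isotropic (hU : IsOpen U) (hF : IsFinslerMetric U F) {x y : E n}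
    (hp : (x, y) ∈ slit U) {a : ℝ} {τ : E n → ℝ}
    (hR : ∀ u, riemannMap F x y u = a • u + τ u • y)
    (h0 : ∀ u, fderiv ℝ (fun p : E n × E n => F p.1 p.2) (x, y) (0, riemannMap F x y u) = 0)
    {u : E n} (hu : 0 < fundForm F x y y y * fundForm F x y u u - fundForm F x y y u ^ 2) :
    flagCurv F x y u = a / F x y ^ 2 := by
  have hF0 := hF.pos x hp.1 y hp.2
  have e1 := fderiv_self_of_homog hU hF hp
  have e2 := fun w => fderiv_fderiv_self_of_homog hU hF hp w
  have e3 : ∀ u, fderiv ℝ (fderiv ℝ (fun p : E n × E n => F p.1 p.2)) (x, y) (0, y) (0, u) = 0 := by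
    intro u
    rw [fderiv_fderiv_symm (isOpen_slit hU) hF.smooth hp, e2]
    simp
  have hyv : ∀ v, fundForm F x y y v =
      F x y * fderiv ℝ (fun p : E n × E n => F p.1 p.2) (x, y) (0, v) := by
    intro v
    rw [fundForm_eq hU hF.smooth hp, e1, e3]; ring
  -- Applied to a u + τ(u) y, the vertical differential of F gives a F_y(u) + τ(u) F = 0; this
  -- determines τ(u), so that g_y(R_y(u), u) = a (g_y(u, u) - F_y(u)²).
  have h1 := h0 u
  rw [hR u] at h1
  have h2 : ((0, a • u + τ u • y) : E n × E n) = a • (0, u) + τ u • (0, y) := by simp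
  rw [h2, map_add, map_smul, map_smul, e1, smul_eq_mul, smul_eq_mul] at h1
  have hnum : fundForm F x y (riemannMap F x y u) u =
      a * fundForm F x y u u + τ u * fundForm F x y y u := by
    rw [fundForm_eq hU hF.smooth hp, fundForm_eq hU hF.smooth hp, fundForm_eq hU hF.smooth hp,
      hR u, h2]
    simp only [map_add, map_smul, smul_eq_mul, add_apply, smul_apply]
    ring
  have hyy : fundForm F x y y y = F x y ^ 2 := by rw [hyv, e1]; ring
  rw [flagCurv, div_eq_div_iff hu.ne' (by positivity), hnum, hyy, hyv]
  linear_combination F x y ^ 2 * fderiv ℝ (fun p : E n × E n => F p.1 p.2) (x, y) (0, u) * h1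

lemma flag_denominator_pos (hU : IsOpen U) (hF : IsFinslerMetric U F) {x y u : E n}
    (hp : (x, y) ∈ slit U) (hu : LinearIndependent ℝ ![y, u]) :
    0 < fundForm F x y y y * fundForm F x y u u - fundForm F x y y u ^ 2 := by
  have hb := fun u v => fundForm_eq hU hF.smooth hp u v
  have hy := hF.posDef x hp.1 y hp.2 y hp.2
  set f := fun p : E n × E n => F p.1 p.2
  set A := fundForm F x y y y with hA
  set B := fundForm F x y y u with hB
  -- Up to the factor A = g_y(y, y), this is the component of u that is g_y-orthogonal to y; its
  -- squared length is A times the Gram determinant.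
  set v : E n := A • u - B • y with hv
  have hv0 : v ≠ 0 := by
    intro h
    have := LinearIndependent.pair_iff.1 hu (-B) A (by rw [← h, hv]; module)
    exact hy.ne' this.2
  have hpos := hF.posDef x hp.1 y hp.2 v hv0
  have hsym := fderiv_fderiv_symm (isOpen_slit hU) hF.smooth hp (0, u) (0, y)
  have e : fundForm F x y v v = A * (A * fundForm F x y u u - B ^ 2) := by
    have h2 : ((0, v) : E n × E n) = A • (0, u) - B • (0, y) := by simp [hv]
    rw [hb v v, h2, hb u u]
    simp only [map_sub, map_smul, smul_eq_mul, sub_apply, smul_apply]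
    have hA' := hA.trans (hb y y)
    have hB' := hB.trans (hb y u)
    rw [hsym]
    linear_combination B^2 * (-hA') + 2 * A * B * hB'
  rw [e] at hpos
  exact (mul_pos_iff_of_pos_left hy).1 hpos

/-! ### Douglas curvature -/

lemma partialD_bilin (B : E n →L[ℝ] E n →L[ℝ] ℝ) (l : Fin n) (w : E n) :
    partialD l (fun w => B w w) w =
      (B (EuclideanSpace.single l 1) + B.flip (EuclideanSpace.single l 1)) w := by
  have h : HasFDerivAt (fun w => B w w) _ w := (B.hasFDerivAt).clm_apply (hasFDerivAt_id w)
  rw [partialD, h.fderiv]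
  simp [add_comm]

lemma partialD_clm (φ : E n →L[ℝ] ℝ) (l : Fin n) (w : E n) :
    partialD l (fun w => φ w) w = φ (EuclideanSpace.single l 1) := by
  rw [partialD, φ.hasFDerivAt.fderiv]

lemma partialD_partialD_partialD_bilin (B : E n →L[ℝ] E n →L[ℝ] ℝ) (j k l : Fin n) {S : Set (E n)}
    (hS : IsOpen S) {g : E n → ℝ} (hg : ∀ w ∈ S, g w = B w w) {y : E n} (hy : y ∈ S) :
    partialD j (fun a => partialD k (fun b => partialD l g b) a) y = 0 := by
  have h1 : ∀ w ∈ S, partialD l g w =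
      (B (EuclideanSpace.single l 1) + B.flip (EuclideanSpace.single l 1)) w := by
    intro w hw
    rw [← partialD_bilin]
    exact partialD_congr (by filter_upwards [hS.mem_nhds hw] with z hz using hg z hz) l
  have h2 : ∀ w ∈ S, partialD k (fun b => partialD l g b) w =
      (B (EuclideanSpace.single l 1) + B.flip (EuclideanSpace.single l 1))
        (EuclideanSpace.single k 1) := by
    intro w hw
    rw [← partialD_clm _ k w]
    exact partialD_congr (by filter_upwards [hS.mem_nhds hw] with z hz using h1 z hz) k
  rw [partialD_congr (g := fun _ => (B (EuclideanSpace.single l 1) +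
    B.flip (EuclideanSpace.single l 1)) (EuclideanSpace.single k 1))
    (by filter_upwards [hS.mem_nhds hy] with z hz using h2 z hz) j]
  simp [partialD]

/-- The diagonal terms give nP and Euler's relation for P gives one more P, which is why the Douglas
correction has the factor 1/(n+1). -/
lemma sum_partialD_geodCoeff (hU : IsOpen U) (hF : IsFinslerMetric U F) {P Q : E n × E n → ℝ}
    (hP : ContDiffOn ℝ ∞ P (slit U)) (hQ : ContDiffOn ℝ ∞ Q (slit U))
    (hFG : ∀ q ∈ slit U, ∀ i, geodCoeff F i q.1 q.2 = P q * q.2 i + Q q * q.1 i)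
    {x y : E n} (hp : (x, y) ∈ slit U) (hP1 : fderiv ℝ P (x, y) (0, y) = P (x, y)) :
    ∑ m, partialD m (fun v => geodCoeff F m x v) y =
      (n + 1) * P (x, y) + fderiv ℝ Q (x, y) (0, x) := by
  have hΩ := isOpen_slit hU
  have h : ∀ m, partialD m (fun v => geodCoeff F m x v) y =
      P (x, y) + y m * fderiv ℝ P (x, y) (0, EuclideanSpace.single m 1) +
        x m * fderiv ℝ Q (x, y) (0, EuclideanSpace.single m 1) := by
    intro m
    have e1 : partialD m (fun v => geodCoeff F m x v) y = _ :=
      partialD_snd (diffAt_of_contDiffOn hΩ (contDiffOn_geodCoeff hU hF m) hp) m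
    have h0 : (fun q : E n × E n => geodCoeff F m q.1 q.2) =ᶠ[𝓝 (x, y)]
        fun q => P q * q.2 m + Q q * q.1 m := by
      filter_upwards [hΩ.mem_nhds hp] with q hq using hFG q hq m
    have c2 : HasFDerivAt (fun q : E n × E n => q.2 m)
        ((EuclideanSpace.proj m : E n →L[ℝ] ℝ).comp (ContinuousLinearMap.snd ℝ _ _)) (x, y) :=
      (EuclideanSpace.proj m : E n →L[ℝ] ℝ).hasFDerivAt.comp (x, y) hasFDerivAt_snd
    have c1 : HasFDerivAt (fun q : E n × E n => q.1 m)
        ((EuclideanSpace.proj m : E n →L[ℝ] ℝ).comp (ContinuousLinearMap.fst ℝ _ _)) (x, y) :=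
      (EuclideanSpace.proj m : E n →L[ℝ] ℝ).hasFDerivAt.comp (x, y) hasFDerivAt_fst
    have hd : HasFDerivAt (fun q : E n × E n => P q * q.2 m + Q q * q.1 m) _ (x, y) :=
      ((diffAt_of_contDiffOn hΩ hP hp).hasFDerivAt.mul c2).add
      ((diffAt_of_contDiffOn hΩ hQ hp).hasFDerivAt.mul c1)
    rw [e1, h0.fderiv_eq, hd.fderiv]
    simp
  simp_rw [h]
  rw [Finset.sum_add_distrib, Finset.sum_add_distrib, sum_mul_apply_inr, sum_mul_apply_inr, hP1]
  simp
  ring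

/-- A spray of the form `P y + Q x` with `Q` quadratic in `y` has vanishing Douglas curvature. -/
lemma douglasCurv_eq_zero (hU : IsOpen U) (hF : IsFinslerMetric U F) {P Q : E n × E n → ℝ}
    (hP : ContDiffOn ℝ ∞ P (slit U)) (hQ : ContDiffOn ℝ ∞ Q (slit U))
    (hFG : ∀ q ∈ slit U, ∀ i, geodCoeff F i q.1 q.2 = P q * q.2 i + Q q * q.1 i)
    (hP1 : ∀ q ∈ slit U, fderiv ℝ P q (0, q.2) = P q) {x : E n} (hx : x ∈ U)
    (B : E n →L[ℝ] E n →L[ℝ] ℝ) (φ : E n →L[ℝ] ℝ) (hB : ∀ w, w ≠ 0 → Q (x, w) = B w w)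
    (hφ : ∀ w, w ≠ 0 → fderiv ℝ Q (x, w) (0, x) = φ w) {y : E n} (hy : y ≠ 0) (i j k l : Fin n) :
    douglasCurv F i j k l x y = 0 := by
  -- The terms P yⁱ cancel. What remains is Q xⁱ - Q_y(x) yⁱ / (n+1), a quadratic form in y,
  -- represented here by a bilinear map.
  refine partialD_partialD_partialD_bilin (S := {y : E n | y ≠ 0})
    (x i • B - (1 / ((n : ℝ) + 1)) • φ.smulRight (EuclideanSpace.proj i : E n →L[ℝ] ℝ))
    j k l isOpen_ne ?_ hy
  intro w hw
  have hp : (x, w) ∈ slit U := ⟨hx, hw⟩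
  rw [sum_partialD_geodCoeff hU hF hP hQ hFG hp (hP1 _ hp), hφ w hw]
  have := hFG _ hp i
  simp only at this
  rw [this, hB w hw]
  have hn : (n : ℝ) + 1 ≠ 0 := by positivity
  simp
  field_simp
  ring

end Metric

/-! ### Scalar expressions for the metric and its vertical derivative

Here `R = |x|²`, `Y = |y|²`, `m = ⟨x, y⟩`, `W = a Y + b m²` and `S = W ^ (-1/2)`. -/

noncomputable section Scalars

/-- The metric, up to the exact one-form. -/
def Lf (R a b Y m S : ℝ) : ℝ :=
  ((a + R) * (a * Y + b * m ^ 2) + (a + R * b) * m ^ 2) * S / a ^ 2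

/-- The coefficient of `y` in the vertical gradient of the metric. -/
def Uf (R Y m S : ℝ) : ℝ := S + (R * Y - m ^ 2) * S ^ 3

/-- The coefficient of `x` in the vertical gradient of the metric. -/
def Vf (R a b m S : ℝ) : ℝ :=
  m * ((b * (a + R) + 2 * (a + R * b)) * S - b * (a + R * b) * m ^ 2 * S ^ 3) / a ^ 2

/-- The differential of `a Y + b m²`. -/
def dW (a b Y m da db dY dm : ℝ) : ℝ := da * Y + a * dY + db * m ^ 2 + 2 * b * m * dm

/-- The differential of `Uf`. -/
def dU (R a b Y m S dR da db dY dm : ℝ) : ℝ :=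
  -(dW a b Y m da db dY dm * S ^ 3 / 2) * (1 + 3 * (R * Y - m ^ 2) * S ^ 2)
    + (dR * Y + R * dY - 2 * m * dm) * S ^ 3

/-- The differential of `Vf`. -/
def dV (R a b Y m S dR da db dY dm : ℝ) : ℝ :=
  (dm * ((b * (a + R) + 2 * (a + R * b)) * S - b * (a + R * b) * m ^ 2 * S ^ 3)
    + m * ((db * (a + R) + b * (da + dR) + 2 * (da + dR * b + R * db)) * S
      + (b * (a + R) + 2 * (a + R * b) - 3 * b * (a + R * b) * m ^ 2 * S ^ 2)
        * -(dW a b Y m da db dY dm * S ^ 3 / 2)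
      - (db * (a + R * b) + b * (da + dR * b + R * db)) * m ^ 2 * S ^ 3
      - 2 * b * (a + R * b) * m * dm * S ^ 3)) / a ^ 2
    - 2 * Vf R a b m S * da / a

/-- The differential of `Lf`. -/
def dL (R a b Y m S dR da db dY dm : ℝ) : ℝ :=
  (((da + dR) * (a * Y + b * m ^ 2) + (a + R) * dW a b Y m da db dY dm
      + (da + dR * b + R * db) * m ^ 2 + 2 * (a + R * b) * m * dm) * S
    + ((a + R) * (a * Y + b * m ^ 2) + (a + R * b) * m ^ 2)
        * -(dW a b Y m da db dY dm * S ^ 3 / 2)) / a ^ 2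
    - 2 * Lf R a b Y m S * da / a

lemma hasDerivAt_inv_sqrt {W : ℝ → ℝ} {W' t : ℝ} (hW : HasDerivAt W W' t) (h0 : 0 < W t) :
    HasDerivAt (fun ε => (√(W ε))⁻¹) (-(W' * (√(W t))⁻¹ ^ 3 / 2)) t := by
  have hs : √(W t) ≠ 0 := (Real.sqrt_pos.2 h0).ne'
  refine HasDerivAt.congr_deriv ((hW.sqrt h0.ne').inv hs) ?_
  field_simp

section Deriv

variable {R a b Y m : ℝ → ℝ} {R' a' b' Y' m' t : ℝ}

lemma hasDerivAt_W (ha : HasDerivAt a a' t) (hb : HasDerivAt b b' t) (hY : HasDerivAt Y Y' t)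
    (hm : HasDerivAt m m' t) :
    HasDerivAt (fun ε => a ε * Y ε + b ε * m ε ^ 2)
      (dW (a t) (b t) (Y t) (m t) a' b' Y' m') t := by
  refine HasDerivAt.congr_deriv ((ha.mul hY).add (hb.mul (hm.pow 2))) ?_
  simp [dW]; ring

lemma hasDerivAt_S (ha : HasDerivAt a a' t) (hb : HasDerivAt b b' t) (hY : HasDerivAt Y Y' t)
    (hm : HasDerivAt m m' t) (hW : 0 < a t * Y t + b t * m t ^ 2) :
    HasDerivAt (fun ε => (√(a ε * Y ε + b ε * m ε ^ 2))⁻¹)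
      (-(dW (a t) (b t) (Y t) (m t) a' b' Y' m' *
        (√(a t * Y t + b t * m t ^ 2))⁻¹ ^ 3 / 2)) t :=
  hasDerivAt_inv_sqrt (hasDerivAt_W ha hb hY hm) hW

lemma hasDerivAt_Uf (hR : HasDerivAt R R' t) (ha : HasDerivAt a a' t) (hb : HasDerivAt b b' t)
    (hY : HasDerivAt Y Y' t) (hm : HasDerivAt m m' t) (hW : 0 < a t * Y t + b t * m t ^ 2) :
    HasDerivAt (fun ε => Uf (R ε) (Y ε) (m ε) (√(a ε * Y ε + b ε * m ε ^ 2))⁻¹)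
      (dU (R t) (a t) (b t) (Y t) (m t) (√(a t * Y t + b t * m t ^ 2))⁻¹ R' a' b' Y' m') t := by
  have hS := hasDerivAt_S ha hb hY hm hW
  refine HasDerivAt.congr_deriv (hS.add (((hR.mul hY).sub (hm.pow 2)).mul (hS.pow 3))) ?_
  simp [dU]; ring

lemma hasDerivAt_Vf (hR : HasDerivAt R R' t) (ha : HasDerivAt a a' t) (hb : HasDerivAt b b' t)
    (hY : HasDerivAt Y Y' t) (hm : HasDerivAt m m' t) (hW : 0 < a t * Y t + b t * m t ^ 2)
    (ha0 : a t ≠ 0) :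
    HasDerivAt (fun ε => Vf (R ε) (a ε) (b ε) (m ε) (√(a ε * Y ε + b ε * m ε ^ 2))⁻¹)
      (dV (R t) (a t) (b t) (Y t) (m t) (√(a t * Y t + b t * m t ^ 2))⁻¹ R' a' b' Y' m') t := by
  have hS := hasDerivAt_S ha hb hY hm hW
  have hT := ha.add (hR.mul hb)
  refine HasDerivAt.congr_deriv ((hm.mul (((((hb.mul (ha.add hR)).add (hT.const_mul 2)).mul hS)).sub
    (((hb.mul hT).mul (hm.pow 2)).mul (hS.pow 3)))).div (ha.pow 2) (pow_ne_zero 2 ha0)) ?_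
  simp [dV, Vf]
  field_simp
  ring

lemma hasDerivAt_Lf (hR : HasDerivAt R R' t) (ha : HasDerivAt a a' t) (hb : HasDerivAt b b' t)
    (hY : HasDerivAt Y Y' t) (hm : HasDerivAt m m' t) (hW : 0 < a t * Y t + b t * m t ^ 2)
    (ha0 : a t ≠ 0) :
    HasDerivAt (fun ε => Lf (R ε) (a ε) (b ε) (Y ε) (m ε) (√(a ε * Y ε + b ε * m ε ^ 2))⁻¹)
      (dL (R t) (a t) (b t) (Y t) (m t) (√(a t * Y t + b t * m t ^ 2))⁻¹ R' a' b' Y' m') t := by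
  have hS := hasDerivAt_S ha hb hY hm hW
  have hT := ha.add (hR.mul hb)
  refine HasDerivAt.congr_deriv (((((ha.add hR).mul (hasDerivAt_W ha hb hY hm)).add
    (hT.mul (hm.pow 2))).mul hS).div (ha.pow 2) (pow_ne_zero 2 ha0)) ?_
  simp [dL, Lf]
  field_simp
  ring

end Deriv

/-! ### Algebraic identities behind the vertical Hessian and the Euler–Lagrange equations. -/

section Identities

variable {R a b Y m S : ℝ}

/-- With S kept as a variable and Y eliminated, no square root and no relation is left: each
identity below becomes one between rational functions of independent variables. -/
lemma eq_of_inv_sq (ha : a ≠ 0) (hS : S ≠ 0) (h : S ^ 2 * (a * Y + b * m ^ 2) = 1) :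
    Y = (1 - b * m ^ 2 * S ^ 2) / (a * S ^ 2) := by
  field_simp; linarith

/-- With p = ⟨y,v⟩ and q = ⟨x,v⟩ this identifies the vertical gradient of L as U y + V x. -/
lemma dL_vertical (ha : a ≠ 0) (hS : S ≠ 0) (h : S ^ 2 * (a * Y + b * m ^ 2) = 1) (p q : ℝ) :
    dL R a b Y m S 0 0 0 (2 * p) q = Uf R Y m S * p + Vf R a b m S * q := by
  rw [eq_of_inv_sq ha hS h]
  simp only [dL, Uf, Vf, Lf, dW]
  field_simp
  ring

lemma Uf_Vf_euler (ha : a ≠ 0) (hS : S ≠ 0) (h : S ^ 2 * (a * Y + b * m ^ 2) = 1) :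
    Uf R Y m S * Y + Vf R a b m S * m = Lf R a b Y m S := by
  rw [eq_of_inv_sq ha hS h]
  simp only [Uf, Vf, Lf]
  field_simp
  ring

lemma dL_horizontal (ha : a ≠ 0) (hS : S ≠ 0) (h : S ^ 2 * (a * Y + b * m ^ 2) = 1)
    (a₁ b₁ p q : ℝ) :
    dL R a b Y m S (2 * p) (a₁ * p) (b₁ * p) 0 q =
      dL R a b Y m S 2 a₁ b₁ 0 0 * p + Vf R a b m S * q := by
  have h1 := dL_vertical (R := R) ha hS h 0 q
  have h2 : dL R a b Y m S (2 * p) (a₁ * p) (b₁ * p) 0 q =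
      dL R a b Y m S 2 a₁ b₁ 0 0 * p + dL R a b Y m S 0 0 0 (2 * 0) q := by
    simp only [dL, dW]
    ring
  rw [h2, h1]
  ring

/-- Together with U|v|², the left side makes up the vertical Hessian on (v, v). The right side
separates it into U on the complement of y and a rank-one term in Yq - mp = Y⟨x - (m/Y) y, v⟩. In
terms of φ, U is (φ - sφ_s)/|y| and the coefficient of the rank-one term is proportional to φ_ss. -/
lemma hessian_vertical (ha : a ≠ 0) (hS : S ≠ 0)
    (h : S ^ 2 * (a * Y + b * m ^ 2) = 1) (p q : ℝ) :
    (dU R a b Y m S 0 0 0 (2 * p) q * p + dV R a b Y m S 0 0 0 (2 * p) q * q) * Y ^ 2 =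
      -(Uf R Y m S * p ^ 2) * Y + ((b + 2) * (a * Y + b * m ^ 2) + 3 * b * (R * Y - m ^ 2))
        * Y * S ^ 5 * (Y * q - m * p) ^ 2 := by
  rw [eq_of_inv_sq ha hS h]
  simp only [dU, dV, Uf, Vf, dW]
  field_simp
  ring

/-- This is the other eigenvalue, (φ - sφ_s + (r² - s²)φ_ss)/|y|. In the factored form every factor
is visibly positive, since a + Rb = T. -/
lemma Uf_add (ha : a ≠ 0) (hS : S ≠ 0) (h : S ^ 2 * (a * Y + b * m ^ 2) = 1) :
    Uf R Y m S + ((b + 2) * (a * Y + b * m ^ 2) + 3 * b * (R * Y - m ^ 2)) * S ^ 5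
      * (R * Y - m ^ 2) =
    (a * Y + b * m ^ 2 + 3 * (R * Y - m ^ 2)) * (a + R * b) * Y * S ^ 5 := by
  rw [eq_of_inv_sq ha hS h]
  simp only [Uf]
  field_simp
  ring

/-- The Euler–Lagrange covector of L is a combination of y and x; this identity and the next compare
the two coefficients. That one and the same factor Q solves both is the special feature of L. Here
a₁ and b₁ stand for a'(r)/r and b'(r)/r. -/
lemma eulerLagrange_y (ha : a ≠ 0) (hS : S ≠ 0) (hT : a + R * b ≠ 0)
    (h : S ^ 2 * (a * Y + b * m ^ 2) = 1) (a₁ b₁ : ℝ) :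
    dU R a b Y m S (2 * m) (a₁ * m) (b₁ * m) 0 Y =
      2 * (((a₁ + 2 * b + R * b₁) * Y - b₁ * (R * Y - m ^ 2)) / (4 * (a + R * b))) *
        dU R a b Y m S 0 0 0 (2 * m) R := by
  rw [mul_div_assoc', div_mul_eq_mul_div, eq_div_iff (by simpa using hT), eq_of_inv_sq ha hS h]
  simp only [dU, dW]
  field_simp
  ring

lemma eulerLagrange_x (ha : a ≠ 0) (hS : S ≠ 0) (hT : a + R * b ≠ 0)
    (h : S ^ 2 * (a * Y + b * m ^ 2) = 1) (a₁ b₁ : ℝ) :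
    dV R a b Y m S (2 * m) (a₁ * m) (b₁ * m) 0 Y - dL R a b Y m S 2 a₁ b₁ 0 0 =
      2 * (((a₁ + 2 * b + R * b₁) * Y - b₁ * (R * Y - m ^ 2)) / (4 * (a + R * b))) *
        (Uf R Y m S + dV R a b Y m S 0 0 0 (2 * m) R) := by
  rw [mul_div_assoc', div_mul_eq_mul_div, eq_div_iff (by simpa using hT), eq_of_inv_sq ha hS h]
  simp only [dV, dL, Uf, Vf, Lf, dW]
  field_simp
  ring

end Identities

end Scalars

/-! ### Metrics of the explicit radial form -/

/-- Differentiability comes from f alone, so the explicit expression g has to be differentiated only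
along a line, as a function of one real variable. -/
lemma fderiv_eq_of_hasDerivAt_line {X : Type*} [NormedAddCommGroup X] [NormedSpace ℝ X]
    {f g : X → ℝ} {p w : X} {d : ℝ} {Ω : Set X} (hΩ : IsOpen Ω) (hp : p ∈ Ω)
    (hf : DifferentiableAt ℝ f p) (hfg : ∀ q ∈ Ω, f q = g q)
    (h : HasDerivAt (fun ε : ℝ => g (p + ε • w)) d 0) : fderiv ℝ f p w = d := by
  have hfg' : g =ᶠ[𝓝 p] f := by
    filter_upwards [hΩ.mem_nhds hp] with q hq using (hfg q hq).symm
  have hg := (hf.hasFDerivAt.congr_of_eventuallyEq hfg').hasLineDerivAt w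
  exact HasDerivAt.unique hg h

/-- The quantity `α |y|² + β ⟨x,y⟩²`. -/
noncomputable def radialW (α β : E n → ℝ) (q : E n × E n) : ℝ :=
  α q.1 * ‖q.2‖ ^ 2 + β q.1 * inner ℝ q.1 q.2 ^ 2

/-- `F` is, on `U`, the sum of the one-form `η ⟨x,y⟩` and the function `Lf`. -/
structure IsRadialForm (U : Set (E n)) (F : E n → E n → ℝ) (α β η : E n → ℝ) : Prop where
  smooth : ContDiffOn ℝ ∞ (fun p : E n × E n => F p.1 p.2) (slit U)
  pos : ∀ x ∈ U, ∀ y : E n, y ≠ 0 → 0 < F x y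
  pos_a : ∀ x ∈ U, 0 < α x
  pos_T : ∀ x ∈ U, 0 < α x + ‖x‖ ^ 2 * β x
  pos_W : ∀ q ∈ slit U, 0 < radialW α β q
  eq : ∀ q ∈ slit U, F q.1 q.2 = η q.1 * inner ℝ q.1 q.2 +
    Lf (‖q.1‖ ^ 2) (α q.1) (β q.1) (‖q.2‖ ^ 2) (inner ℝ q.1 q.2) (√(radialW α β q))⁻¹

/-- The coefficient `U` of `y` in the vertical gradient. -/
noncomputable def radialU (α β : E n → ℝ) (q : E n × E n) : ℝ :=
  Uf (‖q.1‖ ^ 2) (‖q.2‖ ^ 2) (inner ℝ q.1 q.2) (√(radialW α β q))⁻¹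

/-- The coefficient `V` of `x` in the vertical gradient. -/
noncomputable def radialV (α β : E n → ℝ) (q : E n × E n) : ℝ :=
  Vf (‖q.1‖ ^ 2) (α q.1) (β q.1) (inner ℝ q.1 q.2) (√(radialW α β q))⁻¹

section Lines

variable (x y v w : E n)

lemma hasDerivAt_line : HasDerivAt (fun ε : ℝ => x + ε • v) v 0 := by
  have h : HasDerivAt (fun ε : ℝ => ε • v) ((1 : ℝ) • v) 0 := (hasDerivAt_id (0 : ℝ)).smul_const v
  simpa using h.const_add x

lemma hasDerivAt_norm_sq_line : HasDerivAt (fun ε : ℝ => ‖x + ε • v‖ ^ 2) (2 * inner ℝ x v) 0 := by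
  simpa using (hasDerivAt_line x v).norm_sq

lemma hasDerivAt_inner_line :
    HasDerivAt (fun ε : ℝ => (inner ℝ (x + ε • v) (y + ε • w) : ℝ))
      (inner ℝ v y + inner ℝ x w) 0 := by
  simpa [add_comm] using (hasDerivAt_line x v).inner ℝ (hasDerivAt_line y w)

end Lines

/-- The expression is affine in K, which ranges over [0, t(NY - p²)] by Cauchy–Schwarz, so it
suffices to control the two ends: one gives u, the other u + Zst. The sign of Zs decides which end
is the smaller. -/
lemma hessian_lower_bound {u Y p X Z s K t N : ℝ} (hu : 0 < u) (hY : 0 < Y)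
    (h1 : X * Y ^ 2 = -(u * p ^ 2) * Y + Z * Y * s * K) (hK : K ≤ t * (N * Y - p ^ 2))
    (hK0 : 0 ≤ K) (hD : 0 ≤ N * Y - p ^ 2) (h2 : 0 < u + Z * s * t) :
    0 ≤ X + u * N ∧ (0 < N * Y - p ^ 2 → 0 < X + u * N) := by
  have h3 : (X + u * N) * Y = u * (N * Y - p ^ 2) + Z * s * K := by
    refine mul_right_cancel₀ hY.ne' ?_
    linear_combination h1
  obtain ⟨c, hc, h4⟩ : ∃ c > 0, c * (N * Y - p ^ 2) ≤ (X + u * N) * Y := by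
    rcases le_or_gt 0 (Z * s) with hz | hz
    · exact ⟨u, hu, by rw [h3]; linarith [mul_nonneg hz hK0]⟩
    · refine ⟨_, h2, ?_⟩
      have := mul_le_mul_of_nonpos_left hK hz.le
      rw [h3]; linarith
  constructor
  · have : 0 ≤ (X + u * N) * Y := (mul_nonneg hc.le hD).trans h4
    exact nonneg_of_mul_nonneg_left this hY
  · intro h0
    exact pos_of_mul_pos_left ((mul_pos hc h0).trans_le h4) hY.le

namespace IsRadialForm

variable {U : Set (E n)} {F : E n → E n → ℝ} {α β η : E n → ℝ} {x y : E n}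

lemma inv_sqrt_ne_zero (h : IsRadialForm U F α β η) {q : E n × E n} (hq : q ∈ slit U) :
    (√(radialW α β q))⁻¹ ≠ 0 :=
  inv_ne_zero (Real.sqrt_pos.2 (h.pos_W q hq)).ne'

lemma inv_sqrt_sq (h : IsRadialForm U F α β η) {q : E n × E n} (hq : q ∈ slit U) :
    (√(radialW α β q))⁻¹ ^ 2 * (α q.1 * ‖q.2‖ ^ 2 + β q.1 * inner ℝ q.1 q.2 ^ 2) = 1 := by
  have h0 := h.pos_W q hq
  rw [inv_pow, Real.sq_sqrt h0.le]
  exact inv_mul_cancel₀ h0.ne'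

/-- The derivative of the metric in an arbitrary direction. -/
lemma fderiv_eq (h : IsRadialForm U F α β η) (hU : IsOpen U) (hp : (x, y) ∈ slit U)
    (w : E n × E n) {a' b' h' : ℝ} (ha : HasDerivAt (fun ε : ℝ => α (x + ε • w.1)) a' 0)
    (hb : HasDerivAt (fun ε : ℝ => β (x + ε • w.1)) b' 0)
    (hh : HasDerivAt (fun ε : ℝ => η (x + ε • w.1)) h' 0) :
    fderiv ℝ (fun p : E n × E n => F p.1 p.2) (x, y) w =
      h' * inner ℝ x y + η x * (inner ℝ w.1 y + inner ℝ x w.2) +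
      dL (‖x‖ ^ 2) (α x) (β x) (‖y‖ ^ 2) (inner ℝ x y) (√(radialW α β (x, y)))⁻¹
        (2 * inner ℝ x w.1) a' b' (2 * inner ℝ y w.2) (inner ℝ w.1 y + inner ℝ x w.2) := by
  refine fderiv_eq_of_hasDerivAt_line (isOpen_slit hU) hp
    (diffAt_of_contDiffOn (isOpen_slit hU) h.smooth hp) h.eq ?_
  have hm := hasDerivAt_inner_line x y w.1 w.2
  have hd := (hh.mul hm).add (hasDerivAt_Lf (hasDerivAt_norm_sq_line x w.1) ha hb
    (hasDerivAt_norm_sq_line y w.2) hm (by simpa [radialW] using h.pos_W _ hp)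
    (by simpa using (h.pos_a x hp.1).ne'))
  simp only [zero_smul, add_zero] at hd
  exact hd

lemma fderiv_vertical (h : IsRadialForm U F α β η) (hU : IsOpen U) (hp : (x, y) ∈ slit U)
    (v : E n) :
    fderiv ℝ (fun p : E n × E n => F p.1 p.2) (x, y) (0, v) =
      η x * inner ℝ x v + radialU α β (x, y) * inner ℝ y v + radialV α β (x, y) * inner ℝ x v := by
  rw [h.fderiv_eq hU hp (0, v) (a' := 0) (b' := 0) (h' := 0) (by simpa using hasDerivAt_const _ _)
    (by simpa using hasDerivAt_const _ _) (by simpa using hasDerivAt_const _ _)]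
  simp only [inner_zero_left, inner_zero_right, mul_zero, zero_mul, zero_add]
  rw [dL_vertical (h.pos_a x hp.1).ne' (h.inv_sqrt_ne_zero hp) (h.inv_sqrt_sq hp)]
  simp only [radialU, radialV]
  ring

/-- The derivative of the vertical gradient in an arbitrary direction. -/
lemma fderiv_fderiv_vertical (h : IsRadialForm U F α β η) (hU : IsOpen U) (hp : (x, y) ∈ slit U)
    (w : E n × E n) (v : E n) {a' b' h' : ℝ}
    (ha : HasDerivAt (fun ε : ℝ => α (x + ε • w.1)) a' 0)
    (hb : HasDerivAt (fun ε : ℝ => β (x + ε • w.1)) b' 0)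
    (hh : HasDerivAt (fun ε : ℝ => η (x + ε • w.1)) h' 0) :
    fderiv ℝ (fderiv ℝ (fun p : E n × E n => F p.1 p.2)) (x, y) w (0, v) =
      h' * inner ℝ x v + η x * inner ℝ w.1 v +
      (dU (‖x‖ ^ 2) (α x) (β x) (‖y‖ ^ 2) (inner ℝ x y) (√(radialW α β (x, y)))⁻¹
        (2 * inner ℝ x w.1) a' b' (2 * inner ℝ y w.2) (inner ℝ w.1 y + inner ℝ x w.2)
          * inner ℝ y v + radialU α β (x, y) * inner ℝ w.2 v) +
      (dV (‖x‖ ^ 2) (α x) (β x) (‖y‖ ^ 2) (inner ℝ x y) (√(radialW α β (x, y)))⁻¹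
        (2 * inner ℝ x w.1) a' b' (2 * inner ℝ y w.2) (inner ℝ w.1 y + inner ℝ x w.2)
          * inner ℝ x v + radialV α β (x, y) * inner ℝ w.1 v) := by
  have hΩ := isOpen_slit hU
  rw [← fderiv_fderiv_apply hΩ h.smooth hp]
  refine fderiv_eq_of_hasDerivAt_line hΩ hp
    (diffAt_of_contDiffOn hΩ (contDiffOn_fderiv_apply hΩ h.smooth contDiffOn_const) hp)
    (fun q hq => h.fderiv_vertical hU hq v) ?_
  have hm := hasDerivAt_inner_line x y w.1 w.2
  have hxv : HasDerivAt (fun ε : ℝ => (inner ℝ (x + ε • w.1) v : ℝ)) (inner ℝ w.1 v) 0 := by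
    simpa using hasDerivAt_inner_line x v w.1 0
  have hyv : HasDerivAt (fun ε : ℝ => (inner ℝ (y + ε • w.2) v : ℝ)) (inner ℝ w.2 v) 0 := by
    simpa using hasDerivAt_inner_line y v w.2 0
  have hW : 0 < α (x + (0 : ℝ) • w.1) * ‖y + (0 : ℝ) • w.2‖ ^ 2 +
      β (x + (0 : ℝ) • w.1) * inner ℝ (x + (0 : ℝ) • w.1) (y + (0 : ℝ) • w.2) ^ 2 := by
    simpa [radialW] using h.pos_W _ hp
  have hdU := hasDerivAt_Uf (hasDerivAt_norm_sq_line x w.1) ha hb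
    (hasDerivAt_norm_sq_line y w.2) hm hW
  have hdV := hasDerivAt_Vf (hasDerivAt_norm_sq_line x w.1) ha hb
    (hasDerivAt_norm_sq_line y w.2) hm hW (by simpa using (h.pos_a x hp.1).ne')
  have hd := ((hh.mul hxv).add (hdU.mul hyv)).add (hdV.mul hxv)
  simp only [zero_smul, add_zero] at hd
  exact hd

lemma hessian (h : IsRadialForm U F α β η) (hU : IsOpen U) (hp : (x, y) ∈ slit U) (u v : E n) :
    fderiv ℝ (fderiv ℝ (fun p : E n × E n => F p.1 p.2)) (x, y) (0, u) (0, v) =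
      dU (‖x‖ ^ 2) (α x) (β x) (‖y‖ ^ 2) (inner ℝ x y) (√(radialW α β (x, y)))⁻¹
        0 0 0 (2 * inner ℝ y u) (inner ℝ x u) * inner ℝ y v + radialU α β (x, y) * inner ℝ u v +
      dV (‖x‖ ^ 2) (α x) (β x) (‖y‖ ^ 2) (inner ℝ x y) (√(radialW α β (x, y)))⁻¹
        0 0 0 (2 * inner ℝ y u) (inner ℝ x u) * inner ℝ x v := by
  rw [h.fderiv_fderiv_vertical hU hp (0, u) v (a' := 0) (b' := 0) (h' := 0)
    (by simpa using hasDerivAt_const _ _)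
    (by simpa using hasDerivAt_const _ _) (by simpa using hasDerivAt_const _ _)]
  simp

lemma radialU_pos (h : IsRadialForm U F α β η) (hp : (x, y) ∈ slit U) :
    0 < radialU α β (x, y) := by
  have hS : 0 < (√(radialW α β (x, y)))⁻¹ := inv_pos.2 (Real.sqrt_pos.2 (h.pos_W _ hp))
  have ht : 0 ≤ ‖x‖ ^ 2 * ‖y‖ ^ 2 - inner ℝ x y ^ 2 := by
    have := real_inner_mul_inner_self_le x y
    rw [real_inner_self_eq_norm_sq, real_inner_self_eq_norm_sq] at this
    nlinarith
  simp only [radialU, Uf]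
  positivity

lemma posDef (h : IsRadialForm U F α β η) (hU : IsOpen U) (hp : (x, y) ∈ slit U) {v : E n}
    (hv : v ≠ 0) : 0 < fundForm F x y v v := by
  have hF := h.pos x hp.1 y hp.2
  have hS : 0 < (√(radialW α β (x, y)))⁻¹ := inv_pos.2 (Real.sqrt_pos.2 (h.pos_W _ hp))
  have hSq := h.inv_sqrt_sq hp
  have hU0 := h.radialU_pos hp
  have hW := h.pos_W _ hp
  have hT := h.pos_T x hp.1
  have ha := h.pos_a x hp.1
  have hY : 0 < ‖y‖ ^ 2 := by have := norm_pos_iff.2 hp.2; positivity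
  rw [fundForm_eq hU h.smooth hp]
  have hD1 := h.fderiv_vertical hU hp
  have hH := h.hessian hU hp v v
  have cs : ∀ u v : E n, (inner ℝ u v : ℝ) ^ 2 ≤ ‖u‖ ^ 2 * ‖v‖ ^ 2 := by
    intro u v
    have := real_inner_mul_inner_self_le u v
    rw [real_inner_self_eq_norm_sq, real_inner_self_eq_norm_sq] at this
    nlinarith
  have e0 : η x * inner ℝ x y + radialU α β (x, y) * ‖y‖ ^ 2 + radialV α β (x, y) * inner ℝ x y
      = F x y := by
    rw [h.eq _ hp]
    have h1 := Uf_Vf_euler (R := ‖x‖ ^ 2) ha.ne' hS.ne' hSq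
    simp only [radialU, radialV] at h1 ⊢
    linear_combination h1
  have hyy : fderiv ℝ (fun p : E n × E n => F p.1 p.2) (x, y) (0, y) = F x y := by
    rw [hD1, real_inner_self_eq_norm_sq, ← e0]
  have h1 := hessian_vertical (R := ‖x‖ ^ 2) ha.ne' hS.ne' hSq (inner ℝ y v) (inner ℝ x v)
  have h2 := Uf_add (R := ‖x‖ ^ 2) ha.ne' hS.ne' hSq
  have hxy := cs x y
  -- Cauchy–Schwarz is applied to the projections of v and x to the complement of y, scaled by |y|²
  -- to avoid division. This gives `hK`, which is sharper than the inequality for x and v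
  -- themselves.
  have hvec : ‖‖y‖ ^ 2 • v - (inner ℝ y v : ℝ) • y‖ ^ 2 =
      ‖y‖ ^ 2 * (‖v‖ ^ 2 * ‖y‖ ^ 2 - inner ℝ y v ^ 2) := by
    rw [norm_sub_sq_real, norm_smul, norm_smul, real_inner_smul_left, real_inner_smul_right,
      real_inner_comm y v, mul_pow, mul_pow]
    simp
    ring
  have hvec2 : ‖‖y‖ ^ 2 • x - (inner ℝ x y : ℝ) • y‖ ^ 2 =
      ‖y‖ ^ 2 * (‖x‖ ^ 2 * ‖y‖ ^ 2 - inner ℝ x y ^ 2) := by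
    rw [norm_sub_sq_real, norm_smul, norm_smul, real_inner_smul_left, real_inner_smul_right,
      mul_pow, mul_pow]
    simp
    ring
  have hcross : (inner ℝ (‖y‖ ^ 2 • x - (inner ℝ x y : ℝ) • y)
      (‖y‖ ^ 2 • v - (inner ℝ y v : ℝ) • y) : ℝ) =
      ‖y‖ ^ 2 * (‖y‖ ^ 2 * inner ℝ x v - inner ℝ x y * inner ℝ y v) := by
    simp only [inner_sub_left, inner_sub_right, real_inner_smul_left, real_inner_smul_right,
      real_inner_self_eq_norm_sq]
    ring
  have hK : (‖y‖ ^ 2 * inner ℝ x v - inner ℝ x y * inner ℝ y v : ℝ) ^ 2 ≤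
      (‖x‖ ^ 2 * ‖y‖ ^ 2 - inner ℝ x y ^ 2) * (‖v‖ ^ 2 * ‖y‖ ^ 2 - inner ℝ y v ^ 2) := by
    have h3 := cs (‖y‖ ^ 2 • x - (inner ℝ x y : ℝ) • y) (‖y‖ ^ 2 • v - (inner ℝ y v : ℝ) • y)
    rw [hvec, hvec2, hcross] at h3
    have hY2 : 0 < (‖y‖ ^ 2) ^ 2 := by positivity
    refine le_of_mul_le_mul_left ?_ hY2
    linarith
  have hD0 : 0 ≤ ‖v‖ ^ 2 * ‖y‖ ^ 2 - inner ℝ y v ^ 2 := by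
    have := cs y v
    linarith
  have h3 : 0 < Uf (‖x‖ ^ 2) (‖y‖ ^ 2) (inner ℝ x y) (√(radialW α β (x, y)))⁻¹ +
      ((β x + 2) * (α x * ‖y‖ ^ 2 + β x * inner ℝ x y ^ 2) +
        3 * β x * (‖x‖ ^ 2 * ‖y‖ ^ 2 - inner ℝ x y ^ 2)) * (√(radialW α β (x, y)))⁻¹ ^ 5 *
        (‖x‖ ^ 2 * ‖y‖ ^ 2 - inner ℝ x y ^ 2) := by
    have hW' : 0 < α x * ‖y‖ ^ 2 + β x * inner ℝ x y ^ 2 := hW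
    have : 0 ≤ ‖x‖ ^ 2 * ‖y‖ ^ 2 - inner ℝ x y ^ 2 := by linarith
    rw [h2]
    simp only
    positivity
  have key := hessian_lower_bound (N := ‖v‖ ^ 2) hU0 hY h1 hK (sq_nonneg _) hD0 h3
  rw [hH, real_inner_self_eq_norm_sq]
  rcases hD0.eq_or_lt with h0 | h0
  -- Equality in Cauchy–Schwarz: v is a multiple c y with c ≠ 0. The Hessian lower bound gives no
  -- strict positivity here, and the term F_y(v)² = c²F² supplies it.
  · have hz : ‖y‖ ^ 2 • v - (inner ℝ y v : ℝ) • y = 0 := by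
      rw [← h0, mul_zero] at hvec
      simpa using hvec
    have hvy : v = ((inner ℝ y v : ℝ) / ‖y‖ ^ 2) • y := by
      rw [sub_eq_zero] at hz
      rw [div_eq_inv_mul, mul_smul, ← hz, smul_smul, inv_mul_cancel₀ hY.ne', one_smul]
    set c := (inner ℝ y v : ℝ) / ‖y‖ ^ 2
    have hc : c ≠ 0 := by
      intro hc
      rw [hc, zero_smul] at hvy
      exact hv hvy
    have hFv : fderiv ℝ (fun p : E n × E n => F p.1 p.2) (x, y) (0, v) = c * F x y := by
      have : ((0, v) : E n × E n) = c • (0, y) := by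
        conv_lhs => rw [hvy]
        simp
      rw [this, map_smul, hyy, smul_eq_mul]
    rw [hFv]
    have hpos : 0 < c * F x y * (c * F x y) := by
      have := mul_self_pos.2 (mul_ne_zero hc hF.ne')
      exact this
    have hnn := mul_nonneg hF.le key.1
    simp only [radialU] at hnn ⊢
    linarith
  · have hnn := mul_pos hF (key.2 h0)
    have := mul_self_nonneg (fderiv ℝ (fun p : E n × E n => F p.1 p.2) (x, y) (0, v))
    simp only [radialU] at hnn ⊢
    linarith

/-- The Euler–Lagrange equations, with `α`, `β`, `η` radial. -/
lemma eulerLagrange (h : IsRadialForm U F α β η) (hU : IsOpen U) (hp : (x, y) ∈ slit U)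
    {a₁ b₁ h₁ κ : ℝ}
    (ha : ∀ w, HasDerivAt (fun ε : ℝ => α (x + ε • w)) (a₁ * inner ℝ x w) 0)
    (hb : ∀ w, HasDerivAt (fun ε : ℝ => β (x + ε • w)) (b₁ * inner ℝ x w) 0)
    (hh : ∀ w, HasDerivAt (fun ε : ℝ => η (x + ε • w)) (h₁ * inner ℝ x w) 0)
    (hκ : κ = ((a₁ + 2 * β x + ‖x‖ ^ 2 * b₁) * ‖y‖ ^ 2
      - b₁ * (‖x‖ ^ 2 * ‖y‖ ^ 2 - inner ℝ x y ^ 2)) / (4 * (α x + ‖x‖ ^ 2 * β x))) (v : E n) :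
    fderiv ℝ (fderiv ℝ (fun p : E n × E n => F p.1 p.2)) (x, y) (y, 0) (0, v) -
      fderiv ℝ (fun p : E n × E n => F p.1 p.2) (x, y) (v, 0) =
    2 * κ * fderiv ℝ (fderiv ℝ (fun p : E n × E n => F p.1 p.2)) (x, y) (0, v) (0, x) := by
  have hS := h.inv_sqrt_ne_zero hp
  have hSq := h.inv_sqrt_sq hp
  have ha0 := (h.pos_a x hp.1).ne'
  have hT := (h.pos_T x hp.1).ne'
  rw [fderiv_fderiv_symm (isOpen_slit hU) h.smooth hp (0, v), h.hessian hU hp,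
    h.fderiv_fderiv_vertical hU hp (y, 0) v (ha y) (hb y) (hh y),
    h.fderiv_eq hU hp (v, 0) (ha v) (hb v) (hh v)]
  simp only [inner_zero_left, inner_zero_right, mul_zero, add_zero]
  have h1 := eulerLagrange_y (R := ‖x‖ ^ 2) ha0 hS hT hSq a₁ b₁
  have h2 := eulerLagrange_x (R := ‖x‖ ^ 2) ha0 hS hT hSq a₁ b₁
  simp only [← hκ] at h1 h2
  rw [dL_horizontal ha0 hS hSq]
  rw [real_inner_self_eq_norm_sq y, real_inner_self_eq_norm_sq x, h1, real_inner_comm x y,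
    real_inner_comm v y]
  simp only [radialU, radialV] at *
  -- The terms from the one-form, h₁⟨x,y⟩⟨x,v⟩ + η⟨y,v⟩, occur in both derivatives on the left and
  -- cancel. The y-components already agree by `h1`.
  linear_combination (inner ℝ x v) * h2

end IsRadialForm

/-! ### Metrics projectively related to the spray `Q x` -/

section Projective

variable {U : Set (E n)} {F : E n → E n → ℝ} {Q : E n × E n → ℝ}

/-- The projective factor of a metric whose spray is projectively related to `Q x`. -/
noncomputable def projFactor (F : E n → E n → ℝ) (Q : E n × E n → ℝ) (q : E n × E n) : ℝ :=
  (fderiv ℝ (fun p : E n × E n => F p.1 p.2) q (q.2, 0) -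
    2 * Q q * fderiv ℝ (fun p : E n × E n => F p.1 p.2) q (0, q.1)) / (2 * F q.1 q.2)

lemma contDiffOn_projFactor (hU : IsOpen U) (hF : IsFinslerMetric U F)
    (hQ : ContDiffOn ℝ ∞ Q (slit U)) : ContDiffOn ℝ ∞ (projFactor F Q) (slit U) := by
  have hΩ := isOpen_slit hU
  unfold projFactor
  refine ContDiffOn.div (ContDiffOn.sub ?_ (ContDiffOn.mul (contDiffOn_const.mul hQ) ?_))
    (contDiffOn_const.mul hF.smooth) ?_
  · exact contDiffOn_fderiv_apply hΩ hF.smooth (contDiff_snd.prodMk contDiff_const).contDiffOn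
  · exact contDiffOn_fderiv_apply hΩ hF.smooth (contDiff_const.prodMk contDiff_fst).contDiffOn
  · intro q hq
    exact mul_ne_zero two_ne_zero (hF.pos _ hq.1 _ hq.2).ne'

lemma projFactor_mul (hF : IsFinslerMetric U F) {q : E n × E n} (hq : q ∈ slit U) :
    2 * F q.1 q.2 * projFactor F Q q = fderiv ℝ (fun p : E n × E n => F p.1 p.2) q (q.2, 0) -
      2 * Q q * fderiv ℝ (fun p : E n × E n => F p.1 p.2) q (0, q.1) := by
  have := (hF.pos _ hq.1 _ hq.2).ne'
  unfold projFactor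
  field_simp

/-- The identity 2FP = F_x(y) - 2Q F_y(x) is differentiated along (0, y). Its right side has degree
two in y, and F has degree one, so Euler's relations leave degree one for P. -/
lemma fderiv_projFactor_self (hU : IsOpen U) (hF : IsFinslerMetric U F)
    (hQ : ContDiffOn ℝ ∞ Q (slit U)) {x y : E n} (hp : (x, y) ∈ slit U)
    (hQ1 : fderiv ℝ Q (x, y) (0, y) = 2 * Q (x, y)) :
    fderiv ℝ (projFactor F Q) (x, y) (0, y) = projFactor F Q (x, y) := by
  have hΩ := isOpen_slit hU
  have hdF := (diffAt_of_contDiffOn hΩ hF.smooth hp).hasFDerivAt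
  have hdQ := (diffAt_of_contDiffOn hΩ hQ hp).hasFDerivAt
  have hdP := (diffAt_of_contDiffOn hΩ (contDiffOn_projFactor hU hF hQ) hp).hasFDerivAt
  have hl : HasFDerivAt (fun q : E n × E n => 2 * F q.1 q.2 * projFactor F Q q) _ (x, y) :=
    (hdF.const_mul 2).mul hdP
  have w1 : HasFDerivAt (fun q : E n × E n => (q.2, (0 : E n)))
      ((ContinuousLinearMap.snd ℝ (E n) (E n)).prod 0) (x, y) :=
    HasFDerivAt.prodMk hasFDerivAt_snd (hasFDerivAt_const (0 : E n) (x, y))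
  have w2 : HasFDerivAt (fun q : E n × E n => ((0 : E n), q.1))
      ((0 : E n × E n →L[ℝ] E n).prod (ContinuousLinearMap.fst ℝ (E n) (E n))) (x, y) :=
    HasFDerivAt.prodMk (hasFDerivAt_const (0 : E n) (x, y)) hasFDerivAt_fst
  have hr : HasFDerivAt (fun q : E n × E n =>
      fderiv ℝ (fun p : E n × E n => F p.1 p.2) q (q.2, 0) -
      2 * Q q * fderiv ℝ (fun p : E n × E n => F p.1 p.2) q (0, q.1)) _ (x, y) :=
    (hasFDerivAt_fderiv_apply hΩ hF.smooth hp w1).sub ((hdQ.const_mul 2).mul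
      (hasFDerivAt_fderiv_apply hΩ hF.smooth hp w2))
  have he : (fun q : E n × E n => 2 * F q.1 q.2 * projFactor F Q q) =ᶠ[𝓝 (x, y)] fun q =>
      fderiv ℝ (fun p : E n × E n => F p.1 p.2) q (q.2, 0) -
      2 * Q q * fderiv ℝ (fun p : E n × E n => F p.1 p.2) q (0, q.1) := by
    filter_upwards [hΩ.mem_nhds hp] with q hq using projFactor_mul hF hq
  have hu := congrArg (fun φ => φ (0, y)) (hl.unique (hr.congr_of_eventuallyEq he))
  have e1 := fderiv_self_of_homog hU hF hp
  have e2 := fun w => fderiv_fderiv_self_of_homog hU hF hp w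
  have e3 : ∀ w, fderiv ℝ (fderiv ℝ (fun p : E n × E n => F p.1 p.2)) (x, y) (0, y) w = _ :=
    fun w => (fderiv_fderiv_symm hΩ hF.smooth hp _ _).trans (e2 w)
  have e4 : fderiv ℝ (fun p : E n × E n => F p.1 p.2) (x, y) (0, 0) = 0 :=
    map_zero (fderiv ℝ (fun p : E n × E n => F p.1 p.2) (x, y))
  have hm := projFactor_mul (Q := Q) hF hp
  simp [e1, e3, e4, hQ1] at hu
  simp only at hm
  have h0 := (hF.pos x hp.1 y hp.2).ne'
  refine mul_left_cancel₀ (mul_ne_zero two_ne_zero h0) ?_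
  linear_combination hu - 2 * hm

/-- The spray coefficients `P y + Q x`. -/
noncomputable def projSpray (F : E n → E n → ℝ) (Q : E n × E n → ℝ) (q : E n × E n) : E n :=
  projFactor F Q q • q.2 + Q q • q.1

lemma contDiffOn_projSpray (hU : IsOpen U) (hF : IsFinslerMetric U F)
    (hQ : ContDiffOn ℝ ∞ Q (slit U)) : ContDiffOn ℝ ∞ (projSpray F Q) (slit U) :=
  ((contDiffOn_projFactor hU hF hQ).smul contDiff_snd.contDiffOn).add
    (hQ.smul contDiff_fst.contDiffOn)

lemma fderiv_projSpray (hU : IsOpen U) (hF : IsFinslerMetric U F) {q : E n × E n}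
    (hq : q ∈ slit U) :
    fderiv ℝ (fun p : E n × E n => F p.1 p.2) q (q.2, 0) =
      2 * fderiv ℝ (fun p : E n × E n => F p.1 p.2) q (0, projSpray F Q q) := by
  have hm := projFactor_mul (Q := Q) hF hq
  have e1 := fderiv_self_of_homog hU hF (x := q.1) (y := q.2) hq
  have e : ((0, projSpray F Q q) : E n × E n) = projFactor F Q q • (0, q.2) + Q q • (0, q.1) := by
    simp [projSpray]
  rw [e, map_add, map_smul, map_smul, smul_eq_mul, smul_eq_mul, e1]
  linear_combination -hm

/-- The vertical Hessian of a function of degree one kills y, so the summand P y is invisible to it;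
P is determined by the conservation law instead. -/
lemma fderiv_fderiv_projSpray (hU : IsOpen U) (hF : IsFinslerMetric U F) {q : E n × E n}
    (hq : q ∈ slit U) (v : E n) :
    fderiv ℝ (fderiv ℝ (fun p : E n × E n => F p.1 p.2)) q (0, v) (0, projSpray F Q q) =
      Q q * fderiv ℝ (fderiv ℝ (fun p : E n × E n => F p.1 p.2)) q (0, v) (0, q.1) := by
  have e2 := fderiv_fderiv_self_of_homog hU hF (x := q.1) (y := q.2) hq (0, v)
  have e : ((0, projSpray F Q q) : E n × E n) = projFactor F Q q • (0, q.2) + Q q • (0, q.1) := by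
    simp [projSpray]
  rw [e, map_add, map_smul, map_smul, smul_eq_mul, smul_eq_mul, e2]
  ring

lemma geodCoeff_eq_projSpray (hU : IsOpen U) (hF : IsFinslerMetric U F)
    (hEL : ∀ q ∈ slit U, ∀ v,
    fderiv ℝ (fderiv ℝ (fun p : E n × E n => F p.1 p.2)) q (q.2, 0) (0, v) -
      fderiv ℝ (fun p : E n × E n => F p.1 p.2) q (v, 0) =
    2 * Q q * fderiv ℝ (fderiv ℝ (fun p : E n × E n => F p.1 p.2)) q (0, v) (0, q.1))
    {q : E n × E n} (hq : q ∈ slit U) (i : Fin n) : geodCoeff F i q.1 q.2 = projSpray F Q q i := by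
  refine geodCoeff_eq_of_eulerLagrange hU hF (x := q.1) (y := q.2) hq _
    (fderiv_projSpray hU hF hq) (fun v => ?_) i
  have h1 := hEL q hq v
  have h2 := fderiv_fderiv_projSpray (Q := Q) hU hF hq v
  simp only [Prod.mk.eta] at *
  rw [h1, h2]; ring

lemma fderiv_sprayDir_projSpray (hU : IsOpen U) (hF : IsFinslerMetric U F) {q : E n × E n}
    (hq : q ∈ slit U) :
    fderiv ℝ (fun p : E n × E n => F p.1 p.2) q (sprayDir (projSpray F Q) q) = 0 := by
  have e : sprayDir (projSpray F Q) q = (q.2, 0) - (2 : ℝ) • (0, projSpray F Q q) := by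
    simp [sprayDir]
  rw [e, map_sub, map_smul, fderiv_projSpray (Q := Q) hU hF hq, smul_eq_mul, sub_self]

lemma fderiv_fderiv_sprayDir_projSpray (hU : IsOpen U) (hF : IsFinslerMetric U F)
    (hEL : ∀ q ∈ slit U, ∀ v,
    fderiv ℝ (fderiv ℝ (fun p : E n × E n => F p.1 p.2)) q (q.2, 0) (0, v) -
      fderiv ℝ (fun p : E n × E n => F p.1 p.2) q (v, 0) =
    2 * Q q * fderiv ℝ (fderiv ℝ (fun p : E n × E n => F p.1 p.2)) q (0, v) (0, q.1))
    {q : E n × E n} (hq : q ∈ slit U) (v : E n) :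
    fderiv ℝ (fderiv ℝ (fun p : E n × E n => F p.1 p.2)) q (0, v) (sprayDir (projSpray F Q) q) =
      fderiv ℝ (fun p : E n × E n => F p.1 p.2) q (v, 0) := by
  have e : sprayDir (projSpray F Q) q = (q.2, 0) - (2 : ℝ) • (0, projSpray F Q q) := by
    simp [sprayDir]
  rw [e, map_sub, map_smul, fderiv_fderiv_projSpray (Q := Q) hU hF hq,
    fderiv_fderiv_symm (isOpen_slit hU) hF.smooth hq, smul_eq_mul]
  linarith [hEL q hq v]

end Projective

/-! ### The quadratic function `c₁ |y|² + c₂ ⟨x,y⟩²` -/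

section Quadratic

variable {U : Set (E n)} {F : E n → E n → ℝ} {c₁ c₂ k₁ k₂ : E n → ℝ} {x y : E n}

/-- The function `c₁ |y|² + c₂ ⟨x,y⟩²`. -/
noncomputable def quadQ (c₁ c₂ : E n → ℝ) (q : E n × E n) : ℝ :=
  c₁ q.1 * ‖q.2‖ ^ 2 + c₂ q.1 * inner ℝ q.1 q.2 ^ 2

lemma contDiffOn_quadQ (h₁ : ContDiffOn ℝ ∞ c₁ U) (h₂ : ContDiffOn ℝ ∞ c₂ U) :
    ContDiffOn ℝ ∞ (quadQ c₁ c₂) (slit U) := by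
  have hm : Set.MapsTo Prod.fst (slit U) U := fun q hq => hq.1
  have f₁ : ContDiffOn ℝ ∞ (fun q : E n × E n => c₁ q.1) (slit U) :=
    h₁.comp contDiff_fst.contDiffOn hm
  have f₂ : ContDiffOn ℝ ∞ (fun q : E n × E n => c₂ q.1) (slit U) :=
    h₂.comp contDiff_fst.contDiffOn hm
  exact (f₁.mul (contDiff_snd.norm_sq ℝ).contDiffOn).add
    (f₂.mul ((contDiff_fst.inner ℝ contDiff_snd).contDiffOn.pow 2))

lemma fderiv_quadQ (hU : IsOpen U) (h₁ : ContDiffOn ℝ ∞ c₁ U) (h₂ : ContDiffOn ℝ ∞ c₂ U)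
    (d₁ : ∀ x ∈ U, ∀ w, HasDerivAt (fun ε : ℝ => c₁ (x + ε • w)) (k₁ x * inner ℝ x w) 0)
    (d₂ : ∀ x ∈ U, ∀ w, HasDerivAt (fun ε : ℝ => c₂ (x + ε • w)) (k₂ x * inner ℝ x w) 0)
    (hp : (x, y) ∈ slit U) (w : E n × E n) :
    fderiv ℝ (quadQ c₁ c₂) (x, y) w =
      k₁ x * inner ℝ x w.1 * ‖y‖ ^ 2 + c₁ x * (2 * inner ℝ y w.2) +
      (k₂ x * inner ℝ x w.1 * inner ℝ x y ^ 2 +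
        c₂ x * (2 * inner ℝ x y * (inner ℝ w.1 y + inner ℝ x w.2))) := by
  refine fderiv_eq_of_hasDerivAt_line (isOpen_slit hU) hp
    (diffAt_of_contDiffOn (isOpen_slit hU) (contDiffOn_quadQ h₁ h₂) hp) (fun _ _ => rfl) ?_
  have hd := ((d₁ x hp.1 w.1).mul (hasDerivAt_norm_sq_line y w.2)).add
    ((d₂ x hp.1 w.1).mul ((hasDerivAt_inner_line x y w.1 w.2).pow 2))
  simp only [zero_smul, add_zero, Pi.pow_apply, Nat.cast_ofNat, Nat.add_one_sub_one, pow_one] at hd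
  exact hd

lemma fderiv_fderiv_quadQ (hU : IsOpen U) (h₁ : ContDiffOn ℝ ∞ c₁ U) (h₂ : ContDiffOn ℝ ∞ c₂ U)
    (d₁ : ∀ x ∈ U, ∀ w, HasDerivAt (fun ε : ℝ => c₁ (x + ε • w)) (k₁ x * inner ℝ x w) 0)
    (d₂ : ∀ x ∈ U, ∀ w, HasDerivAt (fun ε : ℝ => c₂ (x + ε • w)) (k₂ x * inner ℝ x w) 0)
    (hp : (x, y) ∈ slit U) (w : E n × E n) (u : E n) :
    fderiv ℝ (fderiv ℝ (quadQ c₁ c₂)) (x, y) w (0, u) =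
      2 * (k₁ x * inner ℝ x w.1 * inner ℝ y u + c₁ x * inner ℝ w.2 u) +
      2 * ((k₂ x * inner ℝ x w.1 * inner ℝ x y + c₂ x * (inner ℝ w.1 y + inner ℝ x w.2))
        * inner ℝ x u + c₂ x * inner ℝ x y * inner ℝ w.1 u) := by
  have hΩ := isOpen_slit hU
  have hQ := contDiffOn_quadQ h₁ h₂
  rw [← fderiv_fderiv_apply hΩ hQ hp]
  refine fderiv_eq_of_hasDerivAt_line hΩ hp
    (g := fun q => 2 * (c₁ q.1 * inner ℝ q.2 u) + 2 * (c₂ q.1 * inner ℝ q.1 q.2 * inner ℝ q.1 u))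
    (diffAt_of_contDiffOn hΩ (contDiffOn_fderiv_apply hΩ hQ contDiffOn_const) hp)
    (fun q hq => ?_) ?_
  · rw [fderiv_quadQ hU h₁ h₂ d₁ d₂ (x := q.1) (y := q.2) hq]
    simp only [inner_zero_left, inner_zero_right]
    ring
  · have hxv : HasDerivAt (fun ε : ℝ => (inner ℝ (x + ε • w.1) u : ℝ)) (inner ℝ w.1 u) 0 := by
      simpa using hasDerivAt_inner_line x u w.1 0
    have hyv : HasDerivAt (fun ε : ℝ => (inner ℝ (y + ε • w.2) u : ℝ)) (inner ℝ w.2 u) 0 := by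
      simpa using hasDerivAt_inner_line y u w.2 0
    have hd := (((d₁ x hp.1 w.1).mul hyv).const_mul 2).add
      ((((d₂ x hp.1 w.1).mul (hasDerivAt_inner_line x y w.1 w.2)).mul hxv).const_mul 2)
    simp only [zero_smul, add_zero, Pi.mul_apply] at hd
    exact hd

/-- The Euclidean inner product as a real bilinear map. -/
noncomputable def innerBilin (n : ℕ) : E n →L[ℝ] E n →L[ℝ] ℝ := innerSL ℝ

@[simp] lemma innerBilin_apply (v w : E n) : innerBilin n v w = inner ℝ v w := rfl

/-- A metric projectively related to a spray `Q x` with `Q` quadratic in `y` is Douglas. -/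
lemma isDouglas_of_quadQ (hU : IsOpen U) (hF : IsFinslerMetric U F)
  (h₁ : ContDiffOn ℝ ∞ c₁ U) (h₂ : ContDiffOn ℝ ∞ c₂ U)
  (d₁ : ∀ x ∈ U, ∀ w, HasDerivAt (fun ε : ℝ => c₁ (x + ε • w)) (k₁ x * inner ℝ x w) 0)
  (d₂ : ∀ x ∈ U, ∀ w, HasDerivAt (fun ε : ℝ => c₂ (x + ε • w)) (k₂ x * inner ℝ x w) 0)
  (hEL : ∀ q ∈ slit U, ∀ v,
    fderiv ℝ (fderiv ℝ (fun p : E n × E n => F p.1 p.2)) q (q.2, 0) (0, v) -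
      fderiv ℝ (fun p : E n × E n => F p.1 p.2) q (v, 0) =
    2 * quadQ c₁ c₂ q *
      fderiv ℝ (fderiv ℝ (fun p : E n × E n => F p.1 p.2)) q (0, v) (0, q.1)) : IsDouglas U F := by
  intro x hx y hy i j k l
  have hQ := contDiffOn_quadQ h₁ h₂
  refine douglasCurv_eq_zero hU hF (contDiffOn_projFactor hU hF hQ) hQ (fun q hq i => ?_)
    (fun q hq => ?_) hx
    (c₁ x • innerBilin n + c₂ x • (innerSL ℝ x).smulRight (innerSL ℝ x))
    ((2 * (c₁ x + c₂ x * ‖x‖ ^ 2)) • innerSL ℝ x) (fun w _ => ?_) (fun w hw => ?_) hy i j k l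
  · rw [geodCoeff_eq_projSpray hU hF hEL hq]
    simp [projSpray]
  · refine fderiv_projFactor_self hU hF hQ (x := q.1) (y := q.2) hq ?_
    rw [fderiv_quadQ hU h₁ h₂ d₁ d₂ hq]
    simp [quadQ]
    ring
  · simp [quadQ, sq]
  · rw [fderiv_quadQ hU h₁ h₂ d₁ d₂ ⟨hx, hw⟩]
    simp [real_inner_comm x w]
    ring

/-- If moreover the spray `Q x` is isotropic, the metric has scalar flag curvature. -/
lemma flagCurv_eq_flagCurv_of_quadQ (hU : IsOpen U) (hF : IsFinslerMetric U F)
  (h₁ : ContDiffOn ℝ ∞ c₁ U) (h₂ : ContDiffOn ℝ ∞ c₂ U)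
  (d₁ : ∀ x ∈ U, ∀ w, HasDerivAt (fun ε : ℝ => c₁ (x + ε • w)) (k₁ x * inner ℝ x w) 0)
  (d₂ : ∀ x ∈ U, ∀ w, HasDerivAt (fun ε : ℝ => c₂ (x + ε • w)) (k₂ x * inner ℝ x w) 0)
  (hEL : ∀ q ∈ slit U, ∀ v,
    fderiv ℝ (fderiv ℝ (fun p : E n × E n => F p.1 p.2)) q (q.2, 0) (0, v) -
      fderiv ℝ (fun p : E n × E n => F p.1 p.2) q (v, 0) =
    2 * quadQ c₁ c₂ q *
      fderiv ℝ (fderiv ℝ (fun p : E n × E n => F p.1 p.2)) q (0, v) (0, q.1))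
    (hiso : ∀ x ∈ U, k₁ x - c₂ x + 2 * c₁ x * (c₁ x + c₂ x * ‖x‖ ^ 2) = 0)
    (hp : (x, y) ∈ slit U) {u v : E n} (hu : LinearIndependent ℝ ![y, u])
    (hv : LinearIndependent ℝ ![y, v]) : flagCurv F x y u = flagCurv F x y v := by
  have hΩ := isOpen_slit hU
  have hQ := contDiffOn_quadQ h₁ h₂
  have hG := contDiffOn_projSpray hU hF hQ
  have hFG := fun q hq i => geodCoeff_eq_projSpray hU hF hEL (q := q) hq i
  have hR := fun u => riemannMap_eq hU hF hG hFG hp u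
  have hQ1 : fderiv ℝ (quadQ c₁ c₂) (x, y) (0, y) = 2 * (quadQ c₁ c₂) (x, y) := by
    rw [fderiv_quadQ hU h₁ h₂ d₁ d₂ hp]
    simp [quadQ]
    ring
  have hQ2 : ∀ u, fderiv ℝ (fderiv ℝ (quadQ c₁ c₂)) (x, y) (0, y) (0, u) = fderiv ℝ (quadQ c₁ c₂) (x, y) (0, u) := by
    intro u
    rw [fderiv_quadQ hU h₁ h₂ d₁ d₂ hp, fderiv_fderiv_quadQ hU h₁ h₂ d₁ d₂ hp]
    simp
    ring
  have hQ3 : ∀ u, 2 * fderiv ℝ (quadQ c₁ c₂) (x, y) (u, 0) - fderiv ℝ (fderiv ℝ (quadQ c₁ c₂)) (x, y) (y, 0) (0, u)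
      + 2 * (quadQ c₁ c₂) (x, y) * fderiv ℝ (fderiv ℝ (quadQ c₁ c₂)) (x, y) (0, x) (0, u)
      - fderiv ℝ (quadQ c₁ c₂) (x, y) (0, u) * fderiv ℝ (quadQ c₁ c₂) (x, y) (0, x) = 0 := by
    intro u
    rw [fderiv_quadQ hU h₁ h₂ d₁ d₂ hp, fderiv_quadQ hU h₁ h₂ d₁ d₂ hp,
      fderiv_quadQ hU h₁ h₂ d₁ d₂ hp, fderiv_fderiv_quadQ hU h₁ h₂ d₁ d₂ hp,
      fderiv_fderiv_quadQ hU h₁ h₂ d₁ d₂ hp]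
    simp only [quadQ, inner_zero_left, inner_zero_right, real_inner_self_eq_norm_sq,
      real_inner_comm x y, real_inner_comm y u]
    -- The coefficient of x in the curvature is 2(|y|²⟨x,u⟩ - ⟨x,y⟩⟨y,u⟩) times the expression that
    -- `hiso` makes zero.
    linear_combination (2 * inner ℝ x u * ‖y‖ ^ 2 - 2 * inner ℝ x y * inner ℝ y u) * hiso x hp.1
  obtain ⟨a, τ, ha⟩ := sprayCurv_smul_add_smul hΩ (contDiffOn_projFactor hU hF hQ) hQ hG
    (fun _ _ => rfl) hp hQ1 hQ2 hQ3
  have h0 : ∀ u, fderiv ℝ (fun p : E n × E n => F p.1 p.2) (x, y)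
      (0, riemannMap F x y u) = 0 := by
    intro u
    rw [hR]
    exact fderiv_sprayCurv_eq_zero hΩ hF.smooth hG
      (fun q hq => fderiv_sprayDir_projSpray hU hF hq)
      (fun q hq v => fderiv_fderiv_sprayDir_projSpray hU hF hEL hq v) hp u
  have hR' : ∀ u, riemannMap F x y u = a • u + τ u • y := fun u => (hR u).trans (ha u)
  rw [flagCurv_eq_of_isotropic hU hF hp hR' h0 (flag_denominator_pos hU hF hp hu),
    flagCurv_eq_of_isotropic hU hF hp hR' h0 (flag_denominator_pos hU hF hp hv)]

end Quadratic

/-! ### Radial functions -/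

lemma IsRadiusInterval.nonneg {I : Set ℝ} (hI : IsRadiusInterval I) {r : ℝ} (hr : r ∈ I) :
    0 ≤ r := by
  rcases hI with ⟨ν, _, rfl⟩ | ⟨ν₂, ν₁, h₂, _, rfl⟩ | rfl | ⟨ν, hν, rfl⟩
  · exact hr.1
  · exact h₂.trans hr.1.le
  · exact hr
  · exact hν.trans (le_of_lt hr)

/-- Away from a possible left endpoint 0 the one-sided derivatives in the hypotheses become ordinary
ones, and |x| is smooth. -/
lemma IsRadiusInterval.isOpen_inter {I : Set ℝ} (hI : IsRadiusInterval I) :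
    IsOpen (I ∩ Set.Ioi 0) := by
  rcases hI with ⟨ν, hν, rfl⟩ | ⟨ν₂, ν₁, h₂, _, rfl⟩ | rfl | ⟨ν, hν, rfl⟩
  · have : Set.Ico 0 ν ∩ Set.Ioi 0 = Set.Ioo 0 ν := by
      ext r; simp only [Set.mem_inter_iff, Set.mem_Ico, Set.mem_Ioi, Set.mem_Ioo]
      exact ⟨fun h => ⟨h.2, h.1.2⟩, fun h => ⟨⟨h.1.le, h.2⟩, h.1⟩⟩
    rw [this]; exact isOpen_Ioo
  · exact isOpen_Ioo.inter isOpen_Ioi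
  · have : Set.Ici (0 : ℝ) ∩ Set.Ioi 0 = Set.Ioi 0 :=
      Set.inter_eq_right.2 Set.Ioi_subset_Ici_self
    rw [this]; exact isOpen_Ioi
  · exact isOpen_Ioi.inter isOpen_Ioi

lemma IsRadiusInterval.isOpen_radialDomain {I : Set ℝ} (hI : IsRadiusInterval I) :
    IsOpen (radialDomain n I) := by
  rcases hI with ⟨ν, hν, rfl⟩ | ⟨ν₂, ν₁, h₂, _, rfl⟩ | rfl | ⟨ν, hν, rfl⟩
  · have : radialDomain n (Set.Ico 0 ν) = (fun x : E n => ‖x‖) ⁻¹' Set.Iio ν := by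
      ext x; simp [radialDomain]
    rw [this]; exact isOpen_Iio.preimage continuous_norm
  · exact isOpen_Ioo.preimage continuous_norm
  · have : radialDomain n (Set.Ici 0) = Set.univ := by
      ext x; simp [radialDomain]
    rw [this]; exact isOpen_univ
  · exact isOpen_Ioi.preimage continuous_norm

lemma contDiffOn_of_hasDerivAt {J : Set ℝ} (hJ : IsOpen J) {f d : ℝ → ℝ}
    (hd : ContDiffOn ℝ ∞ d J) (hf : ∀ r ∈ J, HasDerivAt f (d r) r) : ContDiffOn ℝ ∞ f J := by
  rw [contDiffOn_infty_iff_deriv_of_isOpen hJ]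
  exact ⟨fun r hr => (hf r hr).differentiableAt.differentiableWithinAt,
    hd.congr fun r hr => (hf r hr).deriv⟩

lemma hasDerivAt_radial {f : ℝ → ℝ} {f' : ℝ} {x : E n} (hx : 0 < ‖x‖)
    (hf : HasDerivAt f f' ‖x‖) (w : E n) :
    HasDerivAt (fun ε : ℝ => f ‖x + ε • w‖) (f' / ‖x‖ * inner ℝ x w) 0 := by
  have h1 : HasDerivAt (fun ε : ℝ => ‖x + ε • w‖) (inner ℝ x w / ‖x‖) 0 := by
    have h2 := (hasDerivAt_norm_sq_line x w).sqrt (by simpa using hx.ne')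
    simp only [Real.sqrt_sq (norm_nonneg _), zero_smul, add_zero] at h2
    refine h2.congr_deriv ?_
    field_simp
  have h3 : HasDerivAt f f' ‖x + (0 : ℝ) • w‖ := by simpa using hf
  refine (h3.comp (0 : ℝ) h1).congr_deriv ?_
  ring

lemma contDiffOn_radial {J : Set ℝ} (hJ0 : ∀ r ∈ J, 0 < r) {f : ℝ → ℝ}
    (hf : ContDiffOn ℝ ∞ f J) : ContDiffOn ℝ ∞ (fun x : E n => f ‖x‖) (radialDomain n J) :=
  hf.comp (contDiffOn_id.norm ℝ fun _ hx => norm_pos_iff.1 (hJ0 _ hx)) fun _ hx => hx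

/-! ### The functions `T` and `Tb` -/

section Coefficients

variable {I J : Set ℝ} {g T Tb : ℝ → ℝ}

lemma derivWithin_eq_deriv_of_mem (hJ : IsOpen J) (hJI : J ⊆ I) {r : ℝ} (hr : r ∈ J) :
    derivWithin g I r = deriv g r :=
  derivWithin_of_mem_nhds (mem_of_superset (hJ.mem_nhds hr) hJI)

lemma contDiffOn_deriv_of_isOpen (hJ : IsOpen J) (hg : ContDiffOn ℝ ∞ g J) :
    ContDiffOn ℝ ∞ (deriv g) J :=
  ((contDiffOn_infty_iff_deriv_of_isOpen hJ).1 hg).2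

lemma hasDerivAt_denominator {r : ℝ} (hg : DifferentiableAt ℝ g r) :
    HasDerivAt (fun r => 1 - 2 * r ^ 2 * g r) (-(4 * r * g r + 2 * r ^ 2 * deriv g r)) r := by
  have h1 : HasDerivAt (fun r : ℝ => r ^ 2) (2 * r) r := by simpa using hasDerivAt_pow 2 r
  refine (((h1.const_mul 2).mul hg.hasDerivAt).const_sub 1).congr_deriv ?_
  ring

lemma contDiffOn_denominator (hg : ContDiffOn ℝ ∞ g J) :
    ContDiffOn ℝ ∞ (fun r => 1 - 2 * r ^ 2 * g r) J :=
  contDiffOn_const.sub ((contDiffOn_const.mul (contDiffOn_id.pow 2)).mul hg)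

lemma IsT.contDiffOn (hJ : IsOpen J) (hJI : J ⊆ I) (hg : ContDiffOn ℝ ∞ g J)
    (hne : ∀ r ∈ J, 1 - 2 * r ^ 2 * g r ≠ 0) (hT : IsT I g T) : ContDiffOn ℝ ∞ T J := by
  obtain ⟨A, hA, hTA⟩ := hT
  have hD := contDiffOn_denominator hg
  have hA' : ContDiffOn ℝ ∞ A J :=
    contDiffOn_of_hasDerivAt hJ
      (((contDiffOn_const.mul contDiffOn_id).mul hg).div hD hne)
      fun r hr => (hA r (hJI hr)).hasDerivAt (mem_of_superset (hJ.mem_nhds hr) hJI)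
  exact (hA'.neg.exp.div (hD.pow 2) fun r hr => pow_ne_zero 2 (hne r hr)).congr
    fun r hr => hTA r (hJI hr)

lemma IsT.hasDerivAt (hJ : IsOpen J) (hJI : J ⊆ I) (hg : ContDiffOn ℝ ∞ g J)
    (hne : ∀ r ∈ J, 1 - 2 * r ^ 2 * g r ≠ 0) (hT : IsT I g T) {r : ℝ} (hr : r ∈ J) :
    HasDerivAt T (T r * (4 * r * g r + 4 * r ^ 2 * deriv g r) / (1 - 2 * r ^ 2 * g r)) r := by
  obtain ⟨A, hA, hTA⟩ := hT
  have hA' := (hA r (hJI hr)).hasDerivAt (mem_of_superset (hJ.mem_nhds hr) hJI)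
  have hD := hasDerivAt_denominator (diffAt_of_contDiffOn hJ hg hr)
  have h0 := hne r hr
  have hd := (hA'.neg.exp.div (hD.pow 2) (pow_ne_zero 2 h0)).congr_of_eventuallyEq
    (f₁ := T) (by filter_upwards [hJ.mem_nhds hr] with t ht using hTA t (hJI ht))
  refine hd.congr_deriv ?_
  rw [hTA r (hJI hr)]
  simp only [Pi.neg_apply, Pi.pow_apply]
  generalize 1 - 2 * r ^ 2 * g r = D at h0 ⊢
  field_simp
  ring

lemma IsTbar.hasDerivAt (hJ : IsOpen J) (hJI : J ⊆ I) (hTb : IsTbar I g T Tb) {r : ℝ}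
    (hr : r ∈ J) : HasDerivAt Tb
      (4 * ((deriv g r + 2 * r * g r ^ 2) / (1 - 2 * r ^ 2 * g r) * T r)) r := by
  have h := (hTb r (hJI hr)).hasDerivAt (mem_of_superset (hJ.mem_nhds hr) hJI)
  rwa [derivWithin_eq_deriv_of_mem hJ hJI hr] at h

lemma IsTbar.contDiffOn (hJ : IsOpen J) (hJI : J ⊆ I) (hg : ContDiffOn ℝ ∞ g J)
    (hne : ∀ r ∈ J, 1 - 2 * r ^ 2 * g r ≠ 0) (hT : ContDiffOn ℝ ∞ T J) (hTb : IsTbar I g T Tb) :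
    ContDiffOn ℝ ∞ Tb J :=
  contDiffOn_of_hasDerivAt hJ (contDiffOn_const.mul ((((contDiffOn_deriv_of_isOpen hJ hg).add
    ((contDiffOn_const.mul contDiffOn_id).mul (hg.pow 2))).div
      (contDiffOn_denominator hg) hne).mul hT)) fun _ hr => hTb.hasDerivAt hJ hJI hr

end Coefficients

/-! ### The metric in radial form -/

section RadialForm

variable {I : Set ℝ} {g h T Tb : ℝ → ℝ}

/-- The coefficient of `|y|²` in the radicand. -/
noncomputable def coeffA (T Tb : ℝ → ℝ) (r : ℝ) : ℝ := T r - r ^ 2 * (Tb r + 1)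

lemma abs_inner_div_norm_le (x y : E n) : |inner ℝ x y / ‖y‖| ≤ ‖x‖ := by
  rw [abs_div, abs_norm]
  exact div_le_of_le_mul₀ (norm_nonneg _) (norm_nonneg _) (abs_real_inner_le_norm x y)

lemma radicand_eq {x y : E n} (hy : y ≠ 0) :
    T ‖x‖ - (‖x‖ ^ 2 - (inner ℝ x y / ‖y‖) ^ 2) * (Tb ‖x‖ + 1) =
      radialW (fun x => coeffA T Tb ‖x‖) (fun x => Tb ‖x‖ + 1) (x, y) / ‖y‖ ^ 2 := by
  have := norm_ne_zero_iff.2 hy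
  simp only [radialW, coeffA]
  field_simp
  ring

/-- With a = T - r²(Tb + 1) and b = Tb + 1, the other combinations in φ are T - r²Tb = a + r² and T
= a + r²b, and its radicand is W/|y|². -/
lemma sphMetric_phi_eq {x y : E n} (hy : y ≠ 0)
    (hW : 0 < radialW (fun x => coeffA T Tb ‖x‖) (fun x => Tb ‖x‖ + 1) (x, y)) :
    sphMetric n (phi h T Tb) x y = h ‖x‖ * inner ℝ x y +
      Lf (‖x‖ ^ 2) (coeffA T Tb ‖x‖) (Tb ‖x‖ + 1) (‖y‖ ^ 2) (inner ℝ x y)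
        (√(radialW (fun x => coeffA T Tb ‖x‖) (fun x => Tb ‖x‖ + 1) (x, y)))⁻¹ := by
  have hy0 := norm_pos_iff.2 hy
  simp only [sphMetric, phi]
  rw [radicand_eq hy, Real.sqrt_div hW.le, Real.sqrt_sq hy0.le]
  have hs := (Real.sqrt_pos.2 hW).ne'
  rw [show T ‖x‖ - ‖x‖ ^ 2 * (Tb ‖x‖ + 1) = coeffA T Tb ‖x‖ from rfl, Lf,
    show coeffA T Tb ‖x‖ * ‖y‖ ^ 2 + (Tb ‖x‖ + 1) * inner ℝ x y ^ 2 =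
      radialW (fun x => coeffA T Tb ‖x‖) (fun x => Tb ‖x‖ + 1) (x, y) from rfl,
    show T ‖x‖ - ‖x‖ ^ 2 * Tb ‖x‖ = coeffA T Tb ‖x‖ + ‖x‖ ^ 2 by simp only [coeffA]; ring,
    show coeffA T Tb ‖x‖ + ‖x‖ ^ 2 * (Tb ‖x‖ + 1) = T ‖x‖ by simp only [coeffA]; ring]
  set W := radialW (fun x => coeffA T Tb ‖x‖) (fun x => Tb ‖x‖ + 1) (x, y)
  rw [mul_add, show ‖y‖ * (inner ℝ x y / ‖y‖ * h ‖x‖) = h ‖x‖ * inner ℝ x y by field_simp]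
  congr 1
  -- Positivity of a is not available here; if a = 0, both sides have denominator zero and so are
  -- zero by convention.
  rcases eq_or_ne (coeffA T Tb ‖x‖) 0 with h0 | h0
  · simp [h0]
  · field_simp

lemma sphMetric_homog (φ : ℝ → ℝ → ℝ) (x y : E n) {t : ℝ} (ht : 0 ≤ t) :
    sphMetric n φ x (t • y) = t * sphMetric n φ x y := by
  rcases ht.eq_or_lt with rfl | ht
  · simp [sphMetric]
  · simp only [sphMetric, norm_smul, real_inner_smul_right, Real.norm_eq_abs, abs_of_pos ht]
    rw [mul_div_mul_left _ _ ht.ne', mul_assoc]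

lemma radialW_pos {α β : E n → ℝ} {q : E n × E n}
    (h : 0 < radialW α β q / ‖q.2‖ ^ 2) : 0 < radialW α β q := by
  by_contra hn
  exact absurd h (not_lt.2 (div_nonpos_of_nonpos_of_nonneg (not_lt.1 hn) (by positivity)))

lemma contDiffOn_radialForm {U : Set (E n)} {α β η : E n → ℝ} (hα : ContDiffOn ℝ ∞ α U)
    (hβ : ContDiffOn ℝ ∞ β U) (hη : ContDiffOn ℝ ∞ η U) (hα0 : ∀ x ∈ U, α x ≠ 0)
    (hW : ∀ q ∈ slit U, 0 < radialW α β q) :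
    ContDiffOn ℝ ∞ (fun q : E n × E n => η q.1 * inner ℝ q.1 q.2 +
      Lf (‖q.1‖ ^ 2) (α q.1) (β q.1) (‖q.2‖ ^ 2) (inner ℝ q.1 q.2) (√(radialW α β q))⁻¹)
      (slit U) := by
  have hm : Set.MapsTo Prod.fst (slit U) U := fun q hq => hq.1
  have fα : ContDiffOn ℝ ∞ (fun q : E n × E n => α q.1) (slit U) :=
    hα.comp contDiff_fst.contDiffOn hm
  have fβ : ContDiffOn ℝ ∞ (fun q : E n × E n => β q.1) (slit U) :=
    hβ.comp contDiff_fst.contDiffOn hm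
  have fη : ContDiffOn ℝ ∞ (fun q : E n × E n => η q.1) (slit U) :=
    hη.comp contDiff_fst.contDiffOn hm
  have fR : ContDiffOn ℝ ∞ (fun q : E n × E n => ‖q.1‖ ^ 2) (slit U) :=
    (contDiff_fst.norm_sq ℝ).contDiffOn
  have fm : ContDiffOn ℝ ∞ (fun q : E n × E n => (inner ℝ q.1 q.2 : ℝ)) (slit U) :=
    (contDiff_fst.inner ℝ contDiff_snd).contDiffOn
  have fW : ContDiffOn ℝ ∞ (radialW α β) (slit U) := contDiffOn_quadQ hα hβ
  have fS : ContDiffOn ℝ ∞ (fun q => (√(radialW α β q))⁻¹) (slit U) :=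
    (fW.sqrt fun q hq => (hW q hq).ne').inv fun q hq => (Real.sqrt_pos.2 (hW q hq)).ne'
  unfold Lf
  exact (fη.mul fm).add (((((fα.add fR).mul fW).add ((fα.add (fR.mul fβ)).mul (fm.pow 2))).mul
    fS).div (fα.pow 2) fun q hq => pow_ne_zero 2 (hα0 _ hq.1))

end RadialForm

/-! ### Restriction to x ≠ 0, extension to the origin, and the theorem. -/

section Main

variable {I : Set ℝ} {g h T Tb : ℝ → ℝ}

lemma IsFinslerMetric.mono {U V : Set (E n)} {F : E n → E n → ℝ} (hF : IsFinslerMetric U F)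
    (hVU : V ⊆ U) : IsFinslerMetric V F where
  smooth := hF.smooth.mono (Set.prod_mono hVU subset_rfl)
  pos := fun x hx => hF.pos x (hVU hx)
  homog := fun x hx => hF.homog x (hVU hx)
  posDef := fun x hx => hF.posDef x (hVU hx)

lemma IsRadialForm.mono {U V : Set (E n)} {F : E n → E n → ℝ} {α β η : E n → ℝ}
    (hF : IsRadialForm U F α β η) (hVU : V ⊆ U) : IsRadialForm V F α β η where
  smooth := hF.smooth.mono (Set.prod_mono hVU subset_rfl)
  pos := fun x hx => hF.pos x (hVU hx)
  pos_a := fun x hx => hF.pos_a x (hVU hx)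
  pos_T := fun x hx => hF.pos_T x (hVU hx)
  pos_W := fun q hq => hF.pos_W q ⟨hVU hq.1, hq.2⟩
  eq := fun q hq => hF.eq q ⟨hVU hq.1, hq.2⟩

lemma continuousOn_slice {U : Set (E n)} {f : E n × E n → ℝ} (hf : ContDiffOn ℝ ∞ f (slit U))
    {y : E n} (hy : y ≠ 0) : ContinuousOn (fun x => f (x, y)) U :=
  hf.continuousOn.comp (f := fun x => (x, y)) (by fun_prop) fun _ hx => ⟨hx, hy⟩

lemma continuousOn_flagCurv {U : Set (E n)} {F : E n → E n → ℝ} (hU : IsOpen U)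
    (hF : IsFinslerMetric U F) {y u : E n} (hu : LinearIndependent ℝ ![y, u]) :
    ContinuousOn (fun x => flagCurv F x y u) U := by
  have hy : y ≠ 0 := by simpa using hu.ne_zero 0
  have hg := fun i j => continuousOn_slice (contDiffOn_fundTensor hU hF i j) hy
  have hR := fun i k => continuousOn_slice (contDiffOn_riemannCurv hU hF i k) hy
  have hform : ∀ u v : E n, ContinuousOn (fun x => fundForm F x y u v) U := fun u v =>
    continuousOn_finsetSum _ fun i _ => continuousOn_finsetSum _ fun j _ =>
      ((hg i j).mul continuousOn_const).mul continuousOn_const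
  have hmap : ∀ i, ContinuousOn (fun x => riemannMap F x y u i) U := fun i =>
    show ContinuousOn (fun x => ∑ k, riemannCurv F i k x y * u k) U from
      continuousOn_finsetSum _ fun k _ => (hR i k).mul continuousOn_const
  refine ContinuousOn.div ?_ (((hform y y).mul (hform u u)).sub ((hform y u).pow 2))
    fun x hx => (flag_denominator_pos hU hF ⟨hx, hy⟩ hu).ne'
  exact continuousOn_finsetSum _ fun i _ => continuousOn_finsetSum _ fun j _ =>
      ((hg i j).mul (hmap i)).mul continuousOn_const

/-- Two functions on an open set that are continuous and agree away from the origin agree. -/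
lemma eqOn_of_eqOn_diff_zero (hn : 0 < n) {U : Set (E n)} (hU : IsOpen U) {f₁ f₂ : E n → ℝ}
    (h₁ : ContinuousOn f₁ U) (h₂ : ContinuousOn f₂ U) (h : ∀ x ∈ U, x ≠ 0 → f₁ x = f₂ x)
    {x : E n} (hx : x ∈ U) : f₁ x = f₂ x := by
  rcases eq_or_ne x 0 with rfl | hx0
  · have : Nonempty (Fin n) := ⟨⟨0, hn⟩⟩
    have : NeBot (𝓝[≠] (0 : E n)) := Module.punctured_nhds_neBot ℝ (E n) 0
    have t₁ := (h₁.continuousAt (hU.mem_nhds hx)).tendsto.mono_left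
      (nhdsWithin_le_nhds (s := {0}ᶜ))
    have t₂ := (h₂.continuousAt (hU.mem_nhds hx)).tendsto.mono_left
      (nhdsWithin_le_nhds (s := {0}ᶜ))
    refine tendsto_nhds_unique t₁ (t₂.congr' ?_)
    filter_upwards [self_mem_nhdsWithin, nhdsWithin_le_nhds (hU.mem_nhds hx)] with z hz hzU
    exact (h z hzU hz).symm
  · exact h x hx hx0

lemma isRadialForm_sphMetric (hI : IsRadiusInterval I)
    (hg : ContDiffOn ℝ ∞ g I) (hh : ContDiffOn ℝ ∞ h I)
    (hgne : ∀ r ∈ I, 1 - 2 * r ^ 2 * g r ≠ 0) (hT : IsT I g T) (hTb : IsTbar I g T Tb)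
    (hroot : ∀ r ∈ I, ∀ s : ℝ, |s| ≤ r → 0 < T r - (r ^ 2 - s ^ 2) * (Tb r + 1))
    (hpos : ∀ r ∈ I, ∀ s : ℝ, |s| ≤ r → 0 < phi h T Tb r s)
    (horigin : (0 : ℝ) ∈ I → ∀ y : E n, y ≠ 0 → ContDiffAt ℝ ∞
      (fun p : E n × E n => sphMetric n (phi h T Tb) p.1 p.2) (0, y)) :
    IsRadialForm (radialDomain n I) (sphMetric n (phi h T Tb))
      (fun x => coeffA T Tb ‖x‖) (fun x => Tb ‖x‖ + 1) (fun x => h ‖x‖) := by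
  have hW : ∀ q ∈ slit (radialDomain n I),
      0 < radialW (fun x => coeffA T Tb ‖x‖) (fun x => Tb ‖x‖ + 1) q := by
    intro q hq
    refine radialW_pos ?_
    rw [← radicand_eq (x := q.1) (y := q.2) hq.2]
    exact hroot _ hq.1 _ (abs_inner_div_norm_le _ _)
  have hA : ∀ r ∈ I, 0 < coeffA T Tb r := by
    intro r hr
    -- The radicand is a at s = 0; at s = r it is T, which is used below for the positivity of a +
    -- r²b.
    simpa [coeffA] using hroot r hr 0 (by simpa using hI.nonneg hr)
  set J := I ∩ Set.Ioi 0
  have hJ : IsOpen J := hI.isOpen_inter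
  have hJI : J ⊆ I := Set.inter_subset_left
  have hJ0 : ∀ r ∈ J, 0 < r := fun r hr => hr.2
  have hU₀ : radialDomain n J ⊆ radialDomain n I := fun x hx => hJI hx
  have hU₀o : IsOpen (radialDomain n J) := hJ.preimage continuous_norm
  have hTs := hT.contDiffOn hJ hJI (hg.mono hJI) fun r hr => hgne r (hJI hr)
  have hTbs := hTb.contDiffOn hJ hJI (hg.mono hJI) (fun r hr => hgne r (hJI hr)) hTs
  have hAs : ContDiffOn ℝ ∞ (coeffA T Tb) J :=
    hTs.sub ((contDiffOn_id.pow 2).mul (hTbs.add contDiffOn_const))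
  refine ⟨?_, ?_, fun x hx => hA _ hx, ?_, hW, fun q hq => sphMetric_phi_eq hq.2 (hW q hq)⟩
  · rintro ⟨x, y⟩ hq
    refine ContDiffAt.contDiffWithinAt ?_
    rcases eq_or_ne x 0 with rfl | hx
    -- At the origin the radial coefficients need not be smooth in x, so the smoothness of F there
    -- is the separate assumption.
    · refine horigin ?_ y hq.2
      have := hq.1
      simpa [radialDomain] using this
    · have hq' : (x, y) ∈ slit (radialDomain n J) := ⟨⟨hq.1, norm_pos_iff.2 hx⟩, hq.2⟩
      refine ContDiffOn.contDiffAt ?_ ((isOpen_slit hU₀o).mem_nhds hq')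
      exact (contDiffOn_radialForm (contDiffOn_radial hJ0 hAs)
        (contDiffOn_radial hJ0 (hTbs.add contDiffOn_const))
        (contDiffOn_radial hJ0 (hh.mono hJI)) (fun x hx => (hA _ (hU₀ hx)).ne')
        fun q hq => hW q ⟨hU₀ hq.1, hq.2⟩).congr
        fun q hq => sphMetric_phi_eq hq.2 (hW q ⟨hU₀ hq.1, hq.2⟩)
  · intro x hx y hy
    exact mul_pos (norm_pos_iff.2 hy) (hpos _ hx _ (abs_inner_div_norm_le _ _))
  · intro x hx
    have := hroot _ hx ‖x‖ (by simp)
    simp only [coeffA]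
    linarith

/-- The coefficient of `⟨x,y⟩²` in the spray. -/
noncomputable def coeffC (g : ℝ → ℝ) (r : ℝ) : ℝ :=
  (deriv g r + 2 * r * g r ^ 2) / (r * (1 - 2 * r ^ 2 * g r))

/-- The definitions of T and Tb amount to T'/(4rT) = g + r²c and Tb'/(4rT) = c. Since a + r²b = T
gives a'/r + 2b + rb' = T'/r, the factor found for L is (g + r²c)|y|² - c(r²|y|² - m²) = g|y|² + c
m². -/
lemma eulerLagrange_sphMetric {J : Set ℝ} (hJ : IsOpen J) (hJI : J ⊆ I) (hJ0 : ∀ r ∈ J, 0 < r)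
    (hg : ContDiffOn ℝ ∞ g I) (hh : ContDiffOn ℝ ∞ h I)
    (hgne : ∀ r ∈ I, 1 - 2 * r ^ 2 * g r ≠ 0) (hT : IsT I g T) (hTb : IsTbar I g T Tb)
    (hF : IsRadialForm (radialDomain n J) (sphMetric n (phi h T Tb))
      (fun x => coeffA T Tb ‖x‖) (fun x => Tb ‖x‖ + 1) (fun x => h ‖x‖))
    {q : E n × E n} (hq : q ∈ slit (radialDomain n J)) (v : E n) :
    fderiv ℝ (fderiv ℝ (fun p : E n × E n => sphMetric n (phi h T Tb) p.1 p.2)) q (q.2, 0) (0, v) -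
      fderiv ℝ (fun p : E n × E n => sphMetric n (phi h T Tb) p.1 p.2) q (v, 0) =
    2 * quadQ (fun x => g ‖x‖) (fun x => coeffC g ‖x‖) q *
      fderiv ℝ (fderiv ℝ (fun p : E n × E n => sphMetric n (phi h T Tb) p.1 p.2)) q (0, v)
        (0, q.1) := by
  obtain ⟨x, y⟩ := q
  have hr : ‖x‖ ∈ J := hq.1
  have hr0 := hJ0 _ hr
  have hTd := hT.hasDerivAt hJ hJI (hg.mono hJI) (fun r hr => hgne r (hJI hr)) hr
  have hTbd := hTb.hasDerivAt hJ hJI hr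
  have hhd := (diffAt_of_contDiffOn hJ (hh.mono hJI) hr).hasDerivAt
  have hsq : HasDerivAt (fun r : ℝ => r ^ 2) (2 * ‖x‖) ‖x‖ := by simpa using hasDerivAt_pow 2 ‖x‖
  have hAd : HasDerivAt (coeffA T Tb) _ ‖x‖ := hTd.sub (hsq.mul (hTbd.add_const 1))
  have hTpos : 0 < T ‖x‖ := by
    have := hF.pos_T x hr
    simpa [coeffA] using this
  have hD := hgne _ (hJI hr)
  refine hF.eulerLagrange (hJ.preimage continuous_norm) hq
    (fun w => hasDerivAt_radial hr0 hAd w) (fun w => hasDerivAt_radial hr0 (hTbd.add_const 1) w)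
    (fun w => hasDerivAt_radial hr0 hhd w) ?_ v
  simp only [quadQ, coeffC, coeffA, sub_add_cancel]
  generalize hDe : 1 - 2 * ‖x‖ ^ 2 * g ‖x‖ = D at hD ⊢
  field_simp
  rw [← hDe]
  ring

/-- The metrics `sphMetric n (phi h T Tb)` are Douglas metrics of scalar flag curvature. -/
theorem sphMetric_main (hn : 2 ≤ n) (hI : IsRadiusInterval I)
    (hg : ContDiffOn ℝ ∞ g I) (hh : ContDiffOn ℝ ∞ h I)
    (hgne : ∀ r ∈ I, 1 - 2 * r ^ 2 * g r ≠ 0) (hT : IsT I g T) (hTb : IsTbar I g T Tb)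
    (hroot : ∀ r ∈ I, ∀ s : ℝ, |s| ≤ r → 0 < T r - (r ^ 2 - s ^ 2) * (Tb r + 1))
    (hpos : ∀ r ∈ I, ∀ s : ℝ, |s| ≤ r → 0 < phi h T Tb r s)
    (horigin : (0 : ℝ) ∈ I → ∀ y : E n, y ≠ 0 → ContDiffAt ℝ ∞
      (fun p : E n × E n => sphMetric n (phi h T Tb) p.1 p.2) (0, y)) :
    IsFinslerMetric (radialDomain n I) (sphMetric n (phi h T Tb)) ∧
      IsDouglas (radialDomain n I) (sphMetric n (phi h T Tb)) ∧
      HasScalarFlagCurvature (radialDomain n I) (sphMetric n (phi h T Tb)) := by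
  have hU : IsOpen (radialDomain n I) := hI.isOpen_radialDomain
  have hR := isRadialForm_sphMetric (n := n) hI hg hh hgne hT hTb hroot hpos horigin
  have hF : IsFinslerMetric (radialDomain n I) (sphMetric n (phi h T Tb)) :=
    ⟨hR.smooth, hR.pos, fun x _ y t ht => sphMetric_homog _ x y ht,
      fun x hx y hy v hv => hR.posDef hU ⟨hx, hy⟩ hv⟩
  set J := I ∩ Set.Ioi 0
  have hJ : IsOpen J := hI.isOpen_inter
  have hJI : J ⊆ I := Set.inter_subset_left
  have hJ0 : ∀ r ∈ J, 0 < r := fun r hr => hr.2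
  have hVU : radialDomain n J ⊆ radialDomain n I := fun x hx => hJI hx
  have hV : IsOpen (radialDomain n J) := hJ.preimage continuous_norm
  have hmem : ∀ x ∈ radialDomain n I, x ≠ 0 → x ∈ radialDomain n J :=
    fun x hx h0 => ⟨hx, norm_pos_iff.2 h0⟩
  have hFV := hF.mono hVU
  have hgJ := hg.mono hJI
  have hC : ContDiffOn ℝ ∞ (coeffC g) J :=
    ((contDiffOn_deriv_of_isOpen hJ hgJ).add ((contDiffOn_const.mul contDiffOn_id).mul
      (hgJ.pow 2))).div (contDiffOn_id.mul (contDiffOn_denominator hgJ))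
      fun r hr => mul_ne_zero (hJ0 r hr).ne' (hgne r (hJI hr))
  have h₁ : ContDiffOn ℝ ∞ (fun x : E n => g ‖x‖) (radialDomain n J) := contDiffOn_radial hJ0 hgJ
  have h₂ : ContDiffOn ℝ ∞ (fun x : E n => coeffC g ‖x‖) (radialDomain n J) :=
    contDiffOn_radial hJ0 hC
  have d₁ : ∀ x ∈ radialDomain n J, ∀ w : E n, HasDerivAt (fun ε : ℝ => g ‖x + ε • w‖)
      (deriv g ‖x‖ / ‖x‖ * inner ℝ x w) 0 := fun x hx w =>
    hasDerivAt_radial (hJ0 _ hx) (diffAt_of_contDiffOn hJ hgJ hx).hasDerivAt w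
  have d₂ : ∀ x ∈ radialDomain n J, ∀ w : E n, HasDerivAt (fun ε : ℝ => coeffC g ‖x + ε • w‖)
      (deriv (coeffC g) ‖x‖ / ‖x‖ * inner ℝ x w) 0 := fun x hx w =>
    hasDerivAt_radial (hJ0 _ hx) (diffAt_of_contDiffOn hJ hC hx).hasDerivAt w
  have hEL := fun q hq v =>
    eulerLagrange_sphMetric hJ hJI hJ0 hg hh hgne hT hTb (hR.mono hVU) (q := q) hq v
  -- This equation is linear in c, and `coeffC` is its solution.
  have hiso : ∀ x ∈ radialDomain n J, deriv g ‖x‖ / ‖x‖ - coeffC g ‖x‖ +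
      2 * g ‖x‖ * (g ‖x‖ + coeffC g ‖x‖ * ‖x‖ ^ 2) = 0 := by
    intro x hx
    have hr0 := (hJ0 _ hx).ne'
    have hD := hgne _ (hJI hx)
    simp only [coeffC]
    generalize hDe : 1 - 2 * ‖x‖ ^ 2 * g ‖x‖ = D at hD ⊢
    field_simp
    rw [← hDe]
    ring
  refine ⟨hF, fun x hx y hy i j k l => ?_, ?_⟩
  -- For fixed y ≠ 0 the Douglas curvature is continuous in x on the full domain, so its vanishing
  -- for x ≠ 0 extends to the origin.
  · refine eqOn_of_eqOn_diff_zero (by omega) hU (f₂ := fun _ => 0)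
      (f₁ := fun x => douglasCurv (sphMetric n (phi h T Tb)) i j k l x y)
      (continuousOn_slice (contDiffOn_douglasCurv hU hF i j k l) hy) continuousOn_const (fun z hz hz0 => ?_) hx
    exact isDouglas_of_quadQ hV hFV h₁ h₂ d₁ d₂ hEL z (hmem z hz hz0) y hy i j k l
  · have key : ∀ x ∈ radialDomain n I, ∀ y u v : E n, LinearIndependent ℝ ![y, u] →
        LinearIndependent ℝ ![y, v] → flagCurv (sphMetric n (phi h T Tb)) x y u =
          flagCurv (sphMetric n (phi h T Tb)) x y v := by
      intro x hx y u v hu hv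
      have hy : y ≠ 0 := by simpa using hu.ne_zero 0
      refine eqOn_of_eqOn_diff_zero (by omega) hU (continuousOn_flagCurv hU hF hu)
        (continuousOn_flagCurv hU hF hv) (fun z hz hz0 => ?_) hx
      exact flagCurv_eq_flagCurv_of_quadQ hV hFV h₁ h₂ d₁ d₂ hEL hiso ⟨hmem z hz hz0, hy⟩ hu hv
    classical
    -- K is the flag curvature for an arbitrarily chosen transverse vector; the value 0 serves only
    -- when no such vector exists, where nothing is claimed.
    refine ⟨fun x y => if hu : ∃ u, LinearIndependent ℝ ![y, u] then
      flagCurv (sphMetric n (phi h T Tb)) x y hu.choose else 0, fun x hx y u hu => ?_⟩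
    have hex : ∃ u, LinearIndependent ℝ ![y, u] := ⟨u, hu⟩
    simp only [dif_pos hex]
    exact key x hx y u _ hu hex.choose_spec

end Main

end SphFinsler

theorem mainTheorem8
    (n : ℕ) (hn : 2 ≤ n)
    (I : Set ℝ) (hI : SphFinsler.IsRadiusInterval I)
    (g h T Tb : ℝ → ℝ)
    (hg : ContDiffOn ℝ ∞ g I) (hh : ContDiffOn ℝ ∞ h I)
    (hgne : ∀ r ∈ I, 1 - 2 * r ^ 2 * g r ≠ 0)
    (hT : SphFinsler.IsT I g T) (hTb : SphFinsler.IsTbar I g T Tb)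
    (hroot : ∀ r ∈ I, ∀ s : ℝ, |s| ≤ r → 0 < T r - (r ^ 2 - s ^ 2) * (Tb r + 1))
    (hpos : ∀ r ∈ I, ∀ s : ℝ, |s| ≤ r → 0 < SphFinsler.phi h T Tb r s)
    (horigin : (0 : ℝ) ∈ I → ∀ y : SphFinsler.E n, y ≠ 0 →
      ContDiffAt ℝ ∞
        (fun p : SphFinsler.E n × SphFinsler.E n =>
          SphFinsler.sphMetric n (SphFinsler.phi h T Tb) p.1 p.2) (0, y)) :
    SphFinsler.IsFinslerMetric (SphFinsler.radialDomain n I)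
        (SphFinsler.sphMetric n (SphFinsler.phi h T Tb)) ∧
      SphFinsler.IsDouglas (SphFinsler.radialDomain n I)
        (SphFinsler.sphMetric n (SphFinsler.phi h T Tb)) ∧
      SphFinsler.HasScalarFlagCurvature (SphFinsler.radialDomain n I)
        (SphFinsler.sphMetric n (SphFinsler.phi h T Tb)) := by
  exact SphFinsler.sphMetric_main hn hI hg hh hgne hT hTb hroot hpos horigin
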